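/- Let $G=(V,E,w)$ range over finite simple undirected graphs with positive real edge weights $w:E\to\mathbb{R}^+$, let $n=|V|$, and let $d_G(s,t)$ be the weighted shortest-path distance ($\infty$ if $s,t$ are not connected). For every connected pair $(s,t)$ fix a shortest $s$–$t$ path $\pi(s,t)$ in $G$ (ties may be broken in any way, in particular consistently, so that subpaths of chosen paths are chosen), and let $W(s,t)$ be the largest edge weight on $\pi(s,t)$ (with $W(s,s)=0$). For $c\ge 0$ and $\mathcal{P}\subseteq V\times V$, a subgraph $H$ of $G$ is a pairwise $+cW(\cdot,\cdot)$ spanner of $G$ over $\mathcal{P}$ if $d_H(s,t)\le d_G(s,t)+c\,W(s,t)$ for every connected pair $(s,t)\in\mathcal{P}$; it is an all-pairs $+cW(\cdot,\cdot)$ spanner if this holds with $\mathcal{P}=V\times V$. There are polynomials $q_1,q_2$ with real coefficients, real constants $C_3,C_4,C_5$ and $k\in\mathbb{N}$ such that for every $\varepsilon>0$, every such weighted graph $G$, every such choice of shortest paths and every set $\mathcal{P}\subseteq V\times V$: 1. $G$ has a pairwise $+(2+\varepsilon)W(\cdot,\cdot)$ spanner over $\mathcal{P}$, given by a deterministic construction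 (a function of $\varepsilon$ and the input $(G,\pi,\mathcal{P})$, without randomness), with at most $q_1(1/\varepsilon)\cdot n|\mathcal{P}|^{1/3}$ edges, i.e. $O_\varepsilon(n|\mathcal{P}|^{1/3})$; 2. $G$ has a pairwise $+(6+\varepsilon)W(\cdot,\cdot)$ spanner over $\mathcal{P}$, given by a deterministic construction in the same sense, with at most $q_2(1/\varepsilon)\cdot n|\mathcal{P}|^{1/4}$ edges, i.e. $O_\varepsilon(n|\mathcal{P}|^{1/4})$; 3. $G$ has a pairwise $+2W(\cdot,\cdot)$ spanner over $\mathcal{P}$ with at most $C_3\, n|\mathcal{P}|^{1/3}$ edges; 4. $G$ has a pairwise $+4W(\cdot,\cdot)$ spanner over $\mathcal{P}$ with at most $C_4\, n|\mathcal{P}|^{2/7}$ edges; 5. $G$ has an all-pairs $+4W(\cdot,\cdot)$ spanner with at most $C_5\, n^{7/5}(\log n)^k$ edges, i.e. $\widetilde O(n^{7/5})$. -/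

import Mathlib

open scoped NNReal ENNReal

universe u

/-- An undirected graph on the vertex set `V` with positive edge weights.
Only the values of `weight` on edges of the graph matter. -/
structure WeightedGraph (V : Type u) where
  graph : SimpleGraph V
  weight : Sym2 V → ℝ≥0
  weight_pos : ∀ e ∈ graph.edgeSet, 0 < weight e

namespace WeightedGraph

variable {V : Type u} (G : WeightedGraph V)

/-- Length of a walk (in some graph `H` on the vertices of `G`): the sum of its edge weights. -/
def length {H : SimpleGraph V} {s t : V} (p : H.Walk s t) : ℝ≥0 :=
  (p.edges.map G.weight).sum

/-- The largest edge weight on a walk; it is `0` for the walk without edges. -/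
def maxWeight {H : SimpleGraph V} {s t : V} (p : H.Walk s t) : ℝ≥0 :=
  (p.edges.map G.weight).foldr max 0

/-- The distance from `s` to `t` in `H`, with the edge weights of `G`: the least length of an
`s`-`t` walk, and `∞` if there is none. -/
noncomputable def dist (H : SimpleGraph V) (s t : V) : ℝ≥0∞ :=
  ⨅ p : H.Walk s t, (G.length p : ℝ≥0∞)

/-- A choice of one shortest path `π(s,t)` of `G` for each pair `s`, `t` that is joined by a path,
i.e. a way of breaking ties between shortest paths. No further condition is put on the choice, so
in particular all the consistent ones are included (those for which each subpath of a chosen path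
is itself chosen). -/
structure ShortestPaths where
  path : ∀ {s t : V}, G.graph.Reachable s t → G.graph.Walk s t
  shortest : ∀ {s t : V} (h : G.graph.Reachable s t),
    (G.length (path h) : ℝ≥0∞) = G.dist G.graph s t

variable {G}

/-- `W(s,t)`: the largest edge weight on the chosen shortest path `π(s,t)`. -/
def ShortestPaths.W (π : G.ShortestPaths) {s t : V} (h : G.graph.Reachable s t) : ℝ≥0 :=
  G.maxWeight (π.path h)

/-- `H` is a pairwise `+cW(·,·)` spanner of `G` over the vertex pairs `P`. Nothing is asked of a
pair that is not joined by a path in `G`, its distance in `G` being infinite. -/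
structure IsPairwiseSpanner (π : G.ShortestPaths) (c : ℝ≥0) (P : Set (V × V))
    (H : SimpleGraph V) : Prop where
  subgraph : H ≤ G.graph
  dist_le : ∀ s t : V, (s, t) ∈ P → ∀ h : G.graph.Reachable s t,
    G.dist H s t ≤ G.dist G.graph s t + ((c * π.W h : ℝ≥0) : ℝ≥0∞)

/-- An all-pairs `+cW(·,·)` spanner. -/
def IsAllPairsSpanner (π : G.ShortestPaths) (c : ℝ≥0) (H : SimpleGraph V) : Prop :=
  IsPairwiseSpanner π c Set.univ H

end WeightedGraph

/-- A deterministic construction: a rule that, without any randomness, turns each input (a weighted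
graph on a finite vertex set, with its chosen shortest paths, and a set of vertex pairs) into one
graph on the same vertices. -/
def DeterministicConstruction : Type (u + 1) :=
  ∀ (V : Type u) [Fintype V] (G : WeightedGraph V), G.ShortestPaths → Finset (V × V) →
    SimpleGraph V

/-!
Only the existence of sparse spanners has to be shown: a deterministic construction is a function,
and one is obtained by choosing a spanner for every input. Moreover the `+2W` spanners of the third
part also serve for the first one.

All constructions start from a *light* subgraph `H`, which contains the `d` lightest edges at every
vertex (`exists_isLight`). If a shortest path with largest weight `W` misses `m` edges of `H`, then
at least `d * m / 3` vertices are joined to it by edges of `H` of weight at most `W`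
(`IsLight.exists_nearby`); this is what makes the error local. The paths are then treated according
to `m`.

* If `m` is small, the missing edges are added.
* If `m` is large, the neighbourhood of the path is so large that it contains one of a few roots,
  whose shortest path trees are added (`IsLight.exists_trees_plus_two`). The detour to the root
  costs `2W`.
* Otherwise the missing edges at both ends of the path are added. The neighbourhoods of the two ends
  contain elements `x` and `y` of a small set `R` (`IsLight.exists_bridge_ends`), and it remains to
  join `x` and `y`. For `+4W`, one cheapest completion is added for each pair in `R × R`
  (`exists_cheapest`). For `+(6+ε)W`, path buying is used (`IsLight.exists_path_buying`): the walks
  are considered in the order of increasing `W`, and the edges of one are bought only if it is not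
  yet approximated up to `(2+ε)W`. In this case many distances from `R` improve by a multiple of
  `εW`, and the order ensures that each distance is improved only `O(1/ε)` times.

The hitting sets are greedy (`exists_hitting`). For sets of at least `μ` elements, `O(n / μ)` greedy
choices leave a constant fraction of the pairs unserved, and iterating on these costs only a constant
factor (`ShortestPaths.exists_approx_all`), so that no logarithm appears in the pairwise results. For
all pairs, `O((n / μ) * log n)` choices leave no pair at all.
-/

namespace WeightedGraph

variable {V : Type u} {G : WeightedGraph V} {H K : SimpleGraph V} {s t u v : V}

/-! ### Walks, their real lengths, and the edges they miss -/

variable (G) in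
/-- The length of a walk as a real number, so that lengths can be subtracted. -/
noncomputable def len (p : K.Walk s t) : ℝ := G.length p

@[simp] lemma len_nil : G.len (SimpleGraph.Walk.nil : K.Walk s s) = 0 := by
  simp [len, length]

@[simp] lemma len_cons (h : K.Adj s u) (p : K.Walk u t) :
    G.len (.cons h p) = G.weight s(s, u) + G.len p := by
  simp [len, length]

@[simp] lemma len_append (p : K.Walk s u) (q : K.Walk u t) :
    G.len (p.append q) = G.len p + G.len q := by
  simp [len, length]

@[simp] lemma len_reverse (p : K.Walk s t) : G.len p.reverse = G.len p := by
  simp [len, length]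

lemma len_nonneg (p : K.Walk s t) : 0 ≤ G.len p := NNReal.coe_nonneg _

lemma weight_swap (x y : V) : G.weight s(x, y) = G.weight s(y, x) := by rw [Sym2.eq_swap]

lemma weight_le_maxWeight (p : K.Walk s t) : ∀ e ∈ p.edges, G.weight e ≤ G.maxWeight p := by
  unfold maxWeight
  induction p.edges with
  | nil => simp
  | cons a l ih =>
    intro e he
    rcases List.mem_cons.1 he with rfl | he
    · exact le_max_left _ _
    · exact (ih e he).trans (le_max_right _ _)

variable (G H) in
/-- `H` contains an `s`-`t` walk of length at most `r`. -/
def Within (s t : V) (r : ℝ) : Prop := ∃ p : H.Walk s t, G.len p ≤ r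

lemma Within.mono_graph {r : ℝ} (h : G.Within H s t r) (hK : H ≤ K) : G.Within K s t r := by
  obtain ⟨p, hp⟩ := h
  exact ⟨p.mapLe hK, by simpa [len, length] using hp⟩

lemma Within.mono {r r' : ℝ} (h : G.Within H s t r) (hr : r ≤ r') : G.Within H s t r' :=
  h.imp fun _ hp => hp.trans hr

lemma Within.symm {r : ℝ} (h : G.Within H s t r) : G.Within H t s r := by
  obtain ⟨p, hp⟩ := h
  exact ⟨p.reverse, by simpa using hp⟩

lemma Within.trans {r r' : ℝ} (h : G.Within H s u r) (h' : G.Within H u t r') :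
    G.Within H s t (r + r') := by
  obtain ⟨p, hp⟩ := h
  obtain ⟨q, hq⟩ := h'
  exact ⟨p.append q, by rw [len_append]; exact add_le_add hp hq⟩

lemma Within.of_adj (h : H.Adj s t) : G.Within H s t (G.weight s(s, t)) :=
  ⟨.cons h .nil, by simp⟩

open Classical in
/-- The number of edges of a walk that are not edges of `H`. -/
noncomputable def missing (H : SimpleGraph V) (p : K.Walk s t) : ℕ :=
  p.edges.countP (fun e => e ∉ H.edgeSet)

@[simp] lemma missing_nil : missing H (SimpleGraph.Walk.nil : K.Walk s s) = 0 := by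
  simp [missing]

lemma missing_cons_of_adj (h : K.Adj s u) (p : K.Walk u t) (hH : H.Adj s u) :
    missing H (.cons h p) = missing H p := by
  simp [missing, hH]

lemma missing_cons_of_not_adj (h : K.Adj s u) (p : K.Walk u t) (hH : ¬ H.Adj s u) :
    missing H (.cons h p) = missing H p + 1 := by
  simp [missing, hH]

@[simp] lemma missing_append (p : K.Walk s u) (q : K.Walk u t) :
    missing H (p.append q) = missing H p + missing H q := by
  simp [missing]

@[simp] lemma missing_reverse (p : K.Walk s t) : missing H p.reverse = missing H p := by
  simp [missing, List.countP_reverse]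

/-- A walk with more than `k` missing edges can be cut just before its missing edge number
`k + 1`. -/
lemma exists_split_missing (p : K.Walk s t) (k : ℕ) (hk : k < missing H p) :
    ∃ (u v : V) (q : K.Walk s u) (h : K.Adj u v) (r : K.Walk v t),
      p = q.append (.cons h r) ∧ missing H q = k ∧ ¬ H.Adj u v := by
  induction p generalizing k with
  | nil => simp at hk
  | @cons a b c h p ih =>
    by_cases hH : H.Adj a b
    · rw [missing_cons_of_adj h p hH] at hk
      obtain ⟨u, v, q, h', r, rfl, hq, hn⟩ := ih k hk
      exact ⟨u, v, .cons h q, h', r, by simp, by rw [missing_cons_of_adj h q hH, hq], hn⟩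
    · rw [missing_cons_of_not_adj h p hH] at hk
      cases k with
      | zero => exact ⟨a, b, .nil, h, p, by simp, by simp, hH⟩
      | succ k =>
        obtain ⟨u, v, q, h', r, rfl, hq, hn⟩ := ih k (by omega)
        exact ⟨u, v, .cons h q, h', r, by simp, by rw [missing_cons_of_not_adj h q hH, hq], hn⟩

/-! ### Shortest walks -/

variable (G) in
/-- No walk of `G` with the same ends is shorter than `p`. -/
def IsShortest (p : G.graph.Walk s t) : Prop := ∀ q : G.graph.Walk s t, G.len p ≤ G.len q

lemma IsShortest.middle {a : G.graph.Walk s u} {b : G.graph.Walk u v} {c : G.graph.Walk v t}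
    (h : G.IsShortest (a.append (b.append c))) : G.IsShortest b := by
  intro q
  have := h (a.append (q.append c))
  simp only [len_append] at this
  linarith

lemma IsShortest.left {a : G.graph.Walk s u} {b : G.graph.Walk u t}
    (h : G.IsShortest (a.append b)) : G.IsShortest a := by
  intro q
  have := h (q.append b)
  simp only [len_append] at this
  linarith

lemma IsShortest.right {a : G.graph.Walk s u} {b : G.graph.Walk u t}
    (h : G.IsShortest (a.append b)) : G.IsShortest b := by
  intro q
  have := h (a.append q)
  simp only [len_append] at this
  linarith

lemma IsShortest.reverse {p : G.graph.Walk s t} (h : G.IsShortest p) : G.IsShortest p.reverse := by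
  intro q
  simpa using h q.reverse

lemma ShortestPaths.isShortest (π : G.ShortestPaths) (h : G.graph.Reachable s t) :
    G.IsShortest (π.path h) := by
  intro q
  have h1 : (G.length (π.path h) : ℝ≥0∞) ≤ G.length q := by
    rw [π.shortest h]; exact iInf_le _ q
  exact_mod_cast h1

/-! ### Light initializations and the neighbourhood of a shortest path -/

variable (G) in
/-- Whenever `H` misses an edge `uv` of `G`, it has at least `d` edges at `u` that are no heavier
than `uv`. -/
def IsLight (H : SimpleGraph V) (d : ℕ) : Prop :=
  ∀ u v, G.graph.Adj u v → ¬ H.Adj u v →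
    ∃ N : Finset V, N.card = d ∧ ∀ z ∈ N, H.Adj u z ∧ G.weight s(u, z) ≤ G.weight s(u, v)

lemma IsLight.mono {d : ℕ} (h : G.IsLight H d) (hK : H ≤ K) : G.IsLight K d := by
  intro u v huv hn
  obtain ⟨N, hc, hN⟩ := h u v huv (fun h' => hn (hK h'))
  exact ⟨N, hc, fun z hz => ⟨hK (hN z hz).1, (hN z hz).2⟩⟩

/-- Two vertices `c` and `v` of a shortest walk, in this order, cannot have a common neighbour `z`
if `weight cz + weight zv` is less than the length of the walk between them. -/
lemma IsShortest.not_shortcut {c z v : V} {p : G.graph.Walk c v} (hp : G.IsShortest p)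
    (h1 : G.graph.Adj c z) (h2 : G.graph.Adj v z)
    (h : (G.weight s(c, z) : ℝ) + G.weight s(v, z) < G.len p) : False := by
  have := hp (.cons h1 (.cons h2.symm .nil))
  rw [weight_swap v z] at h
  simp at this
  linarith

/-- `z` is joined by an edge of `H` to some vertex `v` of the walk `p`; this edge has weight at
most `ω`, and is not longer than the part of `p` up to `v`. -/
def IsNearby (G : WeightedGraph V) (H : SimpleGraph V) (ω : ℝ≥0) (p : G.graph.Walk s t)
    (z : V) : Prop :=
  ∃ (v : V) (r₁ : G.graph.Walk s v) (r₂ : G.graph.Walk v t), p = r₁.append r₂ ∧ H.Adj v z ∧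
    (G.weight s(v, z) : ℝ) ≤ G.len r₁ ∧ G.weight s(v, z) ≤ ω

/-- The nearby vertices of the end `p` of a shortest walk can be augmented by a whole
neighbourhood of an earlier vertex `c`, as long as the part `m` between `c` and `p` is longer than
the edges used at `c`. -/
lemma exists_nearby_union {d : ℕ} {ω : ℝ≥0} {β : ℝ} (hHG : H ≤ G.graph) {c x : V}
    {r : G.graph.Walk s c} {m : G.graph.Walk c x} {p : G.graph.Walk x t}
    (hs : G.IsShortest (r.append (m.append p))) {N N' : Finset V} (hN : N.card = d)
    (hNβ : ∀ z ∈ N, H.Adj c z ∧ (G.weight s(c, z) : ℝ) ≤ β ∧ G.weight s(c, z) ≤ ω)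
    (hβr : β ≤ G.len r) (hβm : β < G.len m) (hN' : ∀ z ∈ N', G.IsNearby H ω p z) :
    ∃ M : Finset V, M.card = d + N'.card ∧
      ∀ z ∈ M, G.IsNearby H ω (r.append (m.append p)) z := by
  classical
  have hdisj : Disjoint N N' := by
    rw [Finset.disjoint_left]
    intro z hz hz'
    obtain ⟨v, r₁, r₂, rfl, hv, hl, -⟩ := hN' z hz'
    obtain ⟨hc, hw, -⟩ := hNβ z hz
    have h1 : G.IsShortest (m.append r₁) := by
      rw [SimpleGraph.Walk.append_assoc m] at hs
      exact hs.middle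
    refine h1.not_shortcut (hHG hc) (hHG hv) ?_
    rw [len_append]
    linarith
  refine ⟨N ∪ N', by rw [Finset.card_union_of_disjoint hdisj, hN], ?_⟩
  intro z hz
  rcases Finset.mem_union.1 hz with hz | hz
  · obtain ⟨hc, hw, hω⟩ := hNβ z hz
    exact ⟨c, r, m.append p, rfl, hc, hw.trans hβr, hω⟩
  · obtain ⟨v, r₁, r₂, rfl, hv, hl, hω⟩ := hN' z hz
    refine ⟨v, r.append (m.append r₁), r₂, ?_, hv, ?_, hω⟩
    · simp [← SimpleGraph.Walk.append_assoc]
    · have := len_nonneg (G := G) r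
      have := len_nonneg (G := G) m
      simp only [len_append]
      linarith

/-- A shortest walk that misses `m` edges of a light `H` has at least `d * m / 3` nearby vertices.
Of each three consecutive missing edges, with weights `w₁, w₂, w₃`, the neighbourhood of one
vertex is used: the end of the first edge if `w₁ ≤ w₂`, and otherwise the start of the second.
This makes the neighbourhoods disjoint. -/
lemma IsLight.exists_nearby {d : ℕ} {ω : ℝ≥0} (hL : G.IsLight H d) (hHG : H ≤ G.graph) (m : ℕ) :
    ∀ {s t : V} (p : G.graph.Walk s t), G.IsShortest p → (∀ e ∈ p.edges, G.weight e ≤ ω) →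
      missing H p = m →
      ∃ N : Finset V, d * m ≤ 3 * N.card ∧ ∀ z ∈ N, G.IsNearby H ω p z := by
  induction m using Nat.strong_induction_on with
  | _ m ih =>
  intro s t p hp hω hm
  rcases Nat.eq_zero_or_pos m with rfl | hpos
  · exact ⟨∅, by simp, by simp⟩
  obtain ⟨u₁, v₁, q₁, h₁, p₁, rfl, hq₁, hn₁⟩ := exists_split_missing (H := H) p 0 (by omega)
  rw [missing_append, missing_cons_of_not_adj _ _ hn₁, hq₁] at hm
  have hω₁ : G.weight s(u₁, v₁) ≤ ω := hω _ (by simp)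
  obtain ⟨N₁, hc₁, hN₁⟩ := hL v₁ u₁ h₁.symm (fun h => hn₁ h.symm)
  simp only [weight_swap v₁ u₁] at hN₁
  have hq₁0 := len_nonneg (G := G) q₁
  rcases le_or_gt m 3 with h3 | h3
  · refine ⟨N₁, by rw [hc₁, Nat.mul_comm 3]; gcongr, fun z hz => ?_⟩
    obtain ⟨hz1, hz2⟩ := hN₁ z hz
    refine ⟨v₁, q₁.append (.cons h₁ .nil), p₁, by simp [← SimpleGraph.Walk.append_assoc], hz1, ?_,
      hz2.trans hω₁⟩
    have : (G.weight s(v₁, z) : ℝ) ≤ G.weight s(u₁, v₁) := by exact_mod_cast hz2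
    simp only [len_append, len_cons, len_nil]
    linarith
  obtain ⟨u₂, v₂, q₂, h₂, p₂, rfl, hq₂, hn₂⟩ := exists_split_missing (H := H) p₁ 0 (by omega)
  rw [missing_append, missing_cons_of_not_adj _ _ hn₂, hq₂] at hm
  obtain ⟨u₃, v₃, q₃, h₃, p₃, rfl, hq₃, hn₃⟩ := exists_split_missing (H := H) p₂ 0 (by omega)
  rw [missing_append, missing_cons_of_not_adj _ _ hn₃, hq₃] at hm
  have hq₂0 := len_nonneg (G := G) q₂
  have hq₃0 := len_nonneg (G := G) q₃
  have hw₃ : (0 : ℝ) < G.weight s(u₃, v₃) := by exact_mod_cast G.weight_pos _ h₃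
  have hω₂ : G.weight s(u₂, v₂) ≤ ω := hω _ (by simp)
  have hs₃ : G.IsShortest p₃ := by
    have h1 := hp.right
    rw [← SimpleGraph.Walk.nil_append (.cons h₁ _), ← SimpleGraph.Walk.cons_nil_append] at h1
    have h2 := h1.right.right.right
    rw [← SimpleGraph.Walk.cons_nil_append] at h2
    have h3 := h2.right.right
    rw [← SimpleGraph.Walk.cons_nil_append] at h3
    exact h3.right
  obtain ⟨N', hc', hN'⟩ := ih (m - 3) (by omega) p₃ hs₃ (fun e he => hω e (by simp [he])) (by omega)
  rcases le_or_gt (G.weight s(u₁, v₁)) (G.weight s(u₂, v₂)) with hle | hlt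
  · have e1 : q₁.append (.cons h₁ (q₂.append (.cons h₂ (q₃.append (.cons h₃ p₃))))) =
        (q₁.append (.cons h₁ .nil)).append
          ((q₂.append (.cons h₂ (q₃.append (.cons h₃ .nil)))).append p₃) := by
      simp [← SimpleGraph.Walk.append_assoc]
    rw [e1] at hp ⊢
    have hle' : (G.weight s(u₁, v₁) : ℝ) ≤ G.weight s(u₂, v₂) := by exact_mod_cast hle
    obtain ⟨M, hM, hM'⟩ := exists_nearby_union (β := G.weight s(u₁, v₁)) hHG hp hc₁
      (fun z hz => ⟨(hN₁ z hz).1, by exact_mod_cast (hN₁ z hz).2, (hN₁ z hz).2.trans hω₁⟩)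
      (by simp only [len_append, len_cons, len_nil]; linarith)
      (by simp only [len_append, len_cons, len_nil]; linarith) hN'
    refine ⟨M, ?_, hM'⟩
    obtain ⟨m', rfl⟩ : ∃ m', m = m' + 3 := ⟨m - 3, by omega⟩
    simp only [Nat.add_sub_cancel] at hc'
    rw [hM]; linarith
  · have e1 : q₁.append (.cons h₁ (q₂.append (.cons h₂ (q₃.append (.cons h₃ p₃))))) =
        (q₁.append (.cons h₁ q₂)).append
          ((SimpleGraph.Walk.cons h₂ (q₃.append (.cons h₃ .nil))).append p₃) := by
      simp [← SimpleGraph.Walk.append_assoc]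
    rw [e1] at hp ⊢
    have hlt' : (G.weight s(u₂, v₂) : ℝ) < G.weight s(u₁, v₁) := by exact_mod_cast hlt
    obtain ⟨N₂, hc₂, hN₂⟩ := hL u₂ v₂ h₂ hn₂
    obtain ⟨M, hM, hM'⟩ := exists_nearby_union (β := G.weight s(u₂, v₂)) hHG hp hc₂
      (fun z hz => ⟨(hN₂ z hz).1, by exact_mod_cast (hN₂ z hz).2, (hN₂ z hz).2.trans hω₂⟩)
      (by simp only [len_append, len_cons]; linarith)
      (by simp only [len_append, len_cons, len_nil]; linarith) hN'
    refine ⟨M, ?_, hM'⟩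
    obtain ⟨m', rfl⟩ : ∃ m', m = m' + 3 := ⟨m - 3, by omega⟩
    simp only [Nat.add_sub_cancel] at hc'
    rw [hM]; linarith

/-! ### Graphs with few edges -/

/-- The number of edges of a graph on a finite vertex set. -/
noncomputable def numEdges (H : SimpleGraph V) : ℕ := H.edgeSet.ncard

lemma numEdges_bot : numEdges (⊥ : SimpleGraph V) = 0 := by simp [numEdges]

lemma numEdges_sup_le (H K : SimpleGraph V) : numEdges (H ⊔ K) ≤ numEdges H + numEdges K := by
  unfold numEdges
  rw [SimpleGraph.edgeSet_sup]
  exact Set.ncard_union_le _ _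

lemma numEdges_finset_sup_le {ι : Type*} (Q : Finset ι) (f : ι → SimpleGraph V) (k : ℕ)
    (h : ∀ i ∈ Q, numEdges (f i) ≤ k) : numEdges (Q.sup f) ≤ Q.card * k := by
  classical
  induction Q using Finset.induction_on with
  | empty => simp [numEdges_bot]
  | insert a Q ha ih =>
    rw [Finset.sup_insert, Finset.card_insert_of_notMem ha]
    have h1 := ih fun i hi => h i (Finset.mem_insert_of_mem hi)
    have h2 := h a (Finset.mem_insert_self _ _)
    have := numEdges_sup_le (f a) (Q.sup f)
    linarith

lemma numEdges_fromEdgeSet_le (F : Finset (Sym2 V)) :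
    numEdges (SimpleGraph.fromEdgeSet (F : Set (Sym2 V))) ≤ F.card := by
  unfold numEdges
  rw [SimpleGraph.edgeSet_fromEdgeSet, ← Set.ncard_coe_finset]
  exact Set.ncard_le_ncard Set.sdiff_subset (Finset.finite_toSet _)

/-- The edges of the walk `p` that are missing in `H`. -/
def patch (H : SimpleGraph V) (p : K.Walk s t) : SimpleGraph V :=
  SimpleGraph.fromEdgeSet {e | e ∈ p.edges ∧ e ∉ H.edgeSet}

lemma patch_le (p : K.Walk s t) : patch H p ≤ K := by
  intro a b hab
  simp only [patch, SimpleGraph.fromEdgeSet_adj, Set.mem_ofPred_eq] at hab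
  exact p.edges_subset_edgeSet hab.1.1

lemma numEdges_patch_le (p : K.Walk s t) : numEdges (patch H p) ≤ missing H p := by
  classical
  have : {e | e ∈ p.edges ∧ e ∉ H.edgeSet} =
      ((p.edges.filter (fun e => e ∉ H.edgeSet)).toFinset : Set (Sym2 V)) := by
    ext e; simp
  rw [patch, this]
  refine (numEdges_fromEdgeSet_le _).trans ((List.toFinset_card_le _).trans ?_)
  rw [missing, List.countP_eq_length_filter]

lemma within_sup_patch (p : K.Walk s t) : G.Within (H ⊔ patch H p) s t (G.len p) := by
  refine ⟨p.transfer _ fun e he => ?_, by simp [len, length]⟩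
  by_cases hH : e ∈ H.edgeSet
  · exact SimpleGraph.edgeSet_mono le_sup_left hH
  · refine SimpleGraph.edgeSet_mono (le_sup_right (a := H)) ?_
    rw [patch, SimpleGraph.edgeSet_fromEdgeSet]
    exact ⟨⟨he, hH⟩, K.not_isDiag_of_mem_edgeSet (p.edges_subset_edgeSet he)⟩

/-- Finitely many walks, each with at most `k` missing edges, can be completed. -/
lemma exists_patch_family {ι : Type*} (Q : Finset ι) (a b : ι → V)
    (p : ∀ i, G.graph.Walk (a i) (b i)) (k : ℕ) (hk : ∀ i ∈ Q, missing H (p i) ≤ k) :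
    ∃ K ≤ G.graph, numEdges K ≤ Q.card * k ∧
      ∀ i ∈ Q, G.Within (H ⊔ K) (a i) (b i) (G.len (p i)) := by
  refine ⟨Q.sup fun i => patch H (p i), Finset.sup_le fun i _ => patch_le _,
    numEdges_finset_sup_le _ _ _ fun i hi => (numEdges_patch_le _).trans (hk i hi),
    fun i hi => (within_sup_patch (H := H) (p i)).mono_graph ?_⟩
  exact sup_le_sup_left (Finset.le_sup (f := fun i => patch H (p i)) hi) H

/-- The first `d` elements of a finite set in the order given by `f`. -/
lemma exists_smallest {α : Type*} [DecidableEq α] (A : Finset α) (f : α → ℝ≥0) (d : ℕ) :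
    ∃ B ⊆ A, B.card ≤ d ∧ ∀ v ∈ A, v ∉ B → B.card = d ∧ ∀ z ∈ B, f z ≤ f v := by
  induction d with
  | zero => exact ⟨∅, by simp, by simp, by simp⟩
  | succ d ih =>
    obtain ⟨B, hBA, hB, hmin⟩ := ih
    by_cases hne : (A \ B).Nonempty
    · obtain ⟨x, hx, hxmin⟩ := (A \ B).exists_min_image f hne
      obtain ⟨hxA, hxB⟩ := Finset.mem_sdiff.1 hx
      refine ⟨insert x B, Finset.insert_subset hxA hBA, ?_, fun v hv hvB => ?_⟩
      · rw [Finset.card_insert_of_notMem hxB]; omega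
      · rw [Finset.mem_insert, not_or] at hvB
        refine ⟨by rw [Finset.card_insert_of_notMem hxB, (hmin x hxA hxB).1], fun z hz => ?_⟩
        rcases Finset.mem_insert.1 hz with rfl | hz
        · exact hxmin v (Finset.mem_sdiff.2 ⟨hv, hvB.2⟩)
        · exact (hmin v hv hvB.2).2 z hz
    · refine ⟨B, hBA, by omega, fun v hv hvB => absurd ⟨v, Finset.mem_sdiff.2 ⟨hv, hvB⟩⟩ hne⟩

variable (G) in
/-- The `d` lightest edges at every vertex form a light subgraph. -/
lemma exists_isLight [Fintype V] (d : ℕ) :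
    ∃ H ≤ G.graph, numEdges H ≤ Fintype.card V * d ∧ G.IsLight H d := by
  classical
  choose B hBA hB hmin using fun u : V =>
    exists_smallest (G.graph.neighborFinset u) (fun z => G.weight s(u, z)) d
  have hadj : ∀ u, ∀ z ∈ B u, G.graph.Adj u z := fun u z hz => by simpa using hBA u hz
  let F : Finset (Sym2 V) := Finset.univ.biUnion fun u => (B u).image fun z => s(u, z)
  have hF : ∀ e, e ∈ F ↔ ∃ u, ∃ z ∈ B u, s(u, z) = e := by simp [F]
  have hH : ∀ u, ∀ z ∈ B u, (SimpleGraph.fromEdgeSet (F : Set (Sym2 V))).Adj u z :=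
    fun u z hz => (SimpleGraph.fromEdgeSet_adj _).2 ⟨(hF _).2 ⟨u, z, hz, rfl⟩, (hadj u z hz).ne⟩
  refine ⟨SimpleGraph.fromEdgeSet (F : Set (Sym2 V)), fun a b hab => ?_, ?_, fun u v huv hn => ?_⟩
  · obtain ⟨h1, -⟩ := (SimpleGraph.fromEdgeSet_adj _).1 hab
    obtain ⟨u, z, hz, he⟩ := (hF _).1 h1
    have := hadj u z hz
    rwa [← SimpleGraph.mem_edgeSet, he] at this
  · refine (numEdges_fromEdgeSet_le F).trans (Finset.card_biUnion_le_card_mul _ _ _ fun u _ => ?_)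
    exact Finset.card_image_le.trans (hB u)
  · have hvB : v ∉ B u := fun h => hn (hH u v h)
    obtain ⟨h1, h2⟩ := hmin u v (by simpa using huv) hvB
    exact ⟨B u, h1, fun z hz => ⟨hH u z hz, h2 z hz⟩⟩

open Classical in
/-- The distance in `G` as a real number; the junk value `0` is used for pairs that are not
connected. -/
noncomputable def ShortestPaths.realDist (π : G.ShortestPaths) (s t : V) : ℝ :=
  if h : G.graph.Reachable s t then G.len (π.path h) else 0

lemma ShortestPaths.realDist_eq (π : G.ShortestPaths) (h : G.graph.Reachable s t) :
    π.realDist s t = G.len (π.path h) := by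
  simp [realDist, h]

lemma ShortestPaths.realDist_le (π : G.ShortestPaths) (p : G.graph.Walk s t) :
    π.realDist s t ≤ G.len p := by
  rw [π.realDist_eq p.reachable]
  exact π.isShortest _ p

/-- A shortest path tree of the root `r`. -/
lemma ShortestPaths.exists_tree [Fintype V] (π : G.ShortestPaths) (r : V) :
    ∃ T ≤ G.graph, numEdges T ≤ Fintype.card V ∧
      ∀ v (p : G.graph.Walk r v), G.Within T r v (G.len p) := by
  classical
  have hpar : ∀ v, ∃ y, r ≠ v → G.graph.Reachable r v →
      G.graph.Adj y v ∧ G.graph.Reachable r y ∧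
        π.realDist r y + G.weight s(y, v) ≤ π.realDist r v := by
    intro v
    by_cases h : r ≠ v ∧ G.graph.Reachable r v
    · obtain ⟨y, h1, p, hp⟩ := (π.path h.2).reverse.exists_eq_cons_of_ne h.1.symm
      refine ⟨y, fun _ _ => ⟨h1.symm, p.reverse.reachable, ?_⟩⟩
      have h2 := congrArg G.len hp
      have h3 := π.realDist_le p.reverse
      rw [len_reverse, len_cons] at h2
      rw [len_reverse] at h3
      rw [π.realDist_eq h.2, h2, weight_swap y v]
      linarith
    · exact ⟨v, fun h1 h2 => absurd ⟨h1, h2⟩ h⟩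
  choose y hy using hpar
  let A : Finset V := Finset.univ.filter fun v => r ≠ v ∧ G.graph.Reachable r v
  let F : Finset (Sym2 V) := A.image fun v => s(y v, v)
  have hF : ∀ e, e ∈ F ↔ ∃ v, (r ≠ v ∧ G.graph.Reachable r v) ∧ s(y v, v) = e := by simp [F, A]
  refine ⟨SimpleGraph.fromEdgeSet (F : Set (Sym2 V)), fun a b hab => ?_, ?_, ?_⟩
  · obtain ⟨h1, -⟩ := (SimpleGraph.fromEdgeSet_adj _).1 hab
    obtain ⟨v, ⟨hv1, hv2⟩, he⟩ := (hF _).1 h1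
    have := (hy v hv1 hv2).1
    rwa [← SimpleGraph.mem_edgeSet, he] at this
  · exact (numEdges_fromEdgeSet_le F).trans (Finset.card_image_le.trans (Finset.card_le_univ _))
  · suffices h : ∀ v, G.graph.Reachable r v →
        G.Within (SimpleGraph.fromEdgeSet (F : Set (Sym2 V))) r v (π.realDist r v) from
      fun v p => (h v p.reachable).mono (π.realDist_le p)
    have hwf : WellFounded fun a b : V => π.realDist r a < π.realDist r b :=
      @Finite.wellFounded_of_trans_of_irrefl V _ _ ⟨fun _ _ _ => lt_trans⟩
        ⟨fun _ => lt_irrefl _⟩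
    intro v
    induction v using hwf.induction with
    | _ v ih =>
    intro hv
    by_cases hrv : r = v
    · subst hrv
      rw [π.realDist_eq hv]
      exact ⟨.nil, by rw [len_nil]; exact len_nonneg _⟩
    obtain ⟨h1, h2, h3⟩ := hy v hrv hv
    have hw : (0 : ℝ) < G.weight s(y v, v) := by exact_mod_cast G.weight_pos _ h1
    refine ((ih (y v) (by linarith) h2).trans (Within.of_adj ?_)).mono h3
    exact (SimpleGraph.fromEdgeSet_adj _).2 ⟨(hF _).2 ⟨v, ⟨hrv, hv⟩, rfl⟩, h1.ne⟩

lemma ShortestPaths.exists_trees [Fintype V] (π : G.ShortestPaths) (R : Finset V) :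
    ∃ T ≤ G.graph, numEdges T ≤ R.card * Fintype.card V ∧
      ∀ r ∈ R, ∀ v (p : G.graph.Walk r v), G.Within T r v (G.len p) := by
  choose T hTG hT hd using π.exists_tree
  exact ⟨R.sup T, Finset.sup_le fun r _ => hTG r, numEdges_finset_sup_le _ _ _ fun r _ => hT r,
    fun r hr v p => (hd r v p).mono_graph (Finset.le_sup hr)⟩

/-! ### Hitting sets -/

/-- Greedy hitting set: `j` elements can be chosen such that, of a family of sets with at least
`μ` elements, only a fraction of `exp (-j * μ / n)` is not hit. -/
lemma exists_hitting {V ι : Type*} [Fintype V] [DecidableEq V] (Q : Finset ι) (f : ι → Finset V)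
    (μ : ℝ) (hf : ∀ i ∈ Q, μ ≤ (f i).card) (j : ℕ) :
    ∃ R : Finset V, R.card ≤ j ∧ ((Q.filter fun i => Disjoint (f i) R).card : ℝ) ≤
      Real.exp (-(j * (μ / Fintype.card V))) * Q.card := by
  induction j with
  | zero => exact ⟨∅, by simp, by simp⟩
  | succ j ih =>
    obtain ⟨R, hR, hQ⟩ := ih
    set U := Q.filter fun i => Disjoint (f i) R with hU
    rcases isEmpty_or_nonempty V with hV | hV
    · refine ⟨R, by omega, hQ.trans (le_of_eq ?_)⟩
      simp
    have hn : (0 : ℝ) < Fintype.card V := by exact_mod_cast Fintype.card_pos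
    -- Some element lies in at least the average number of the sets not yet hit.
    obtain ⟨x, hx⟩ : ∃ x : V, μ / Fintype.card V * U.card ≤ (U.filter fun i => x ∈ f i).card := by
      by_contra! hcon
      have h1 : ∑ x : V, ((U.filter fun i => x ∈ f i).card : ℝ) <
          ∑ _x : V, μ / Fintype.card V * U.card :=
        Finset.sum_lt_sum_of_nonempty Finset.univ_nonempty fun x _ => hcon x
      have h2 : ∑ x : V, (U.filter fun i => x ∈ f i).card = ∑ i ∈ U, (f i).card := by
        simp only [Finset.card_filter]
        rw [Finset.sum_comm]
        refine Finset.sum_congr rfl fun i _ => ?_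
        simp
      have h3 : ∑ i ∈ U, μ ≤ ∑ i ∈ U, ((f i).card : ℝ) :=
        Finset.sum_le_sum fun i hi => hf i (Finset.mem_filter.1 hi).1
      rw [← Nat.cast_sum, h2, Nat.cast_sum] at h1
      simp only [Finset.sum_const, Finset.card_univ, nsmul_eq_mul] at h1 h3
      have h4 : (Fintype.card V : ℝ) * (μ / Fintype.card V * U.card) = U.card * μ := by
        field_simp
      linarith
    refine ⟨insert x R, (Finset.card_insert_le _ _).trans (by omega), ?_⟩
    have hsub : (Q.filter fun i => Disjoint (f i) (insert x R)) ⊆ U.filter fun i => x ∉ f i := by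
      intro i hi
      simp only [hU, Finset.mem_filter, Finset.disjoint_insert_right] at hi ⊢
      exact ⟨⟨hi.1, hi.2.2⟩, hi.2.1⟩
    have hcard : ((U.filter fun i => x ∉ f i).card : ℝ) =
        U.card - (U.filter fun i => x ∈ f i).card := by
      rw [eq_sub_iff_add_eq, add_comm]
      exact_mod_cast Finset.card_filter_add_card_filter_not (s := U) (fun i => x ∈ f i)
    have h5 : ((Q.filter fun i => Disjoint (f i) (insert x R)).card : ℝ) ≤
        U.card - (U.filter fun i => x ∈ f i).card :=
      hcard ▸ (by exact_mod_cast Finset.card_le_card hsub)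
    have h6 : 1 - μ / Fintype.card V ≤ Real.exp (-(μ / Fintype.card V)) := by
      have := Real.add_one_le_exp (-(μ / Fintype.card V)); linarith
    calc ((Q.filter fun i => Disjoint (f i) (insert x R)).card : ℝ)
        ≤ (1 - μ / Fintype.card V) * U.card := by linarith
      _ ≤ Real.exp (-(μ / Fintype.card V)) * U.card := by gcongr
      _ ≤ Real.exp (-(μ / Fintype.card V)) *
          (Real.exp (-(j * (μ / Fintype.card V))) * Q.card) := by gcongr
      _ = _ := by
        rw [← mul_assoc, ← Real.exp_add]
        congr 2
        push_cast; ring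

/-! ### Bridges between the two ends of a path -/

/-- `x` and `y` are joined by edges of `H` of weight at most `ω` to vertices `u` and `v` on the
walk `p`, where `u` precedes `v` and where `p` misses at most `k` edges before `u` and at most `k`
edges after `v`. -/
def HasBridge (G : WeightedGraph V) (H : SimpleGraph V) (k : ℕ) (ω : ℝ≥0)
    (p : G.graph.Walk s t) (x y : V) : Prop :=
  ∃ (u v : V) (p₁ : G.graph.Walk s u) (q : G.graph.Walk u v) (p₂ : G.graph.Walk v t),
    p = p₁.append (q.append p₂) ∧ missing H p₁ ≤ k ∧ missing H p₂ ≤ k ∧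
    (H.Adj u x ∧ G.weight s(u, x) ≤ ω) ∧ (H.Adj v y ∧ G.weight s(v, y) ≤ ω)

/-- A shortest walk with more than `k` missing edges has a part with `k` missing edges that has
many neighbours. For `k = 0` these are the neighbours of the start of the first missing edge. -/
lemma IsLight.exists_prefix {d k : ℕ} {ω : ℝ≥0} (hL : G.IsLight H d) (hHG : H ≤ G.graph)
    {p : G.graph.Walk s t} (hp : G.IsShortest p) (hω : ∀ e ∈ p.edges, G.weight e ≤ ω)
    (hk : k < missing H p) :
    ∃ (u : V) (p₁ : G.graph.Walk s u) (p₂ : G.graph.Walk u t) (N : Finset V),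
      p = p₁.append p₂ ∧ missing H p₁ = k ∧ d * (k + 1) ≤ 6 * N.card ∧
      ∀ x ∈ N, ∃ (a : V) (r₁ : G.graph.Walk s a) (r₂ : G.graph.Walk a u),
        p₁ = r₁.append r₂ ∧ H.Adj a x ∧ G.weight s(a, x) ≤ ω := by
  obtain ⟨u, v, p₁, h, r, rfl, hm, hn⟩ := exists_split_missing p k hk
  refine ⟨u, p₁, .cons h r, ?_⟩
  rcases Nat.eq_zero_or_pos k with rfl | hpos
  · obtain ⟨N, hc, hN⟩ := hL u v h hn
    refine ⟨N, rfl, hm, by omega, fun x hx => ⟨u, p₁, .nil, by simp, (hN x hx).1, ?_⟩⟩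
    exact (hN x hx).2.trans (hω _ (by simp))
  · obtain ⟨N, hc, hN⟩ := hL.exists_nearby hHG k p₁ hp.left
      (fun e he => hω e (by simp [he])) hm
    refine ⟨N, rfl, hm, by nlinarith, fun x hx => ?_⟩
    obtain ⟨a, r₁, r₂, h1, h2, -, h3⟩ := hN x hx
    exact ⟨a, r₁, r₂, h1, h2, h3⟩

lemma IsLight.exists_hasBridge {d k : ℕ} {ω : ℝ≥0} (hL : G.IsLight H d) (hHG : H ≤ G.graph)
    {p : G.graph.Walk s t} (hp : G.IsShortest p) (hω : ∀ e ∈ p.edges, G.weight e ≤ ω)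
    (hk : 2 * k < missing H p) :
    ∃ N₁ N₂ : Finset V, d * (k + 1) ≤ 6 * N₁.card ∧ d * (k + 1) ≤ 6 * N₂.card ∧
      ∀ x ∈ N₁, ∀ y ∈ N₂, G.HasBridge H k ω p x y := by
  obtain ⟨u, p₁, p', N₁, rfl, hm, hN₁, hx⟩ := hL.exists_prefix (k := k) hHG hp hω (by omega)
  rw [missing_append] at hk
  obtain ⟨v, p₂, q, N₂, h', hm', hN₂, hy⟩ := hL.exists_prefix (k := k) hHG
    (p := p'.reverse) hp.right.reverse (fun e he => hω e (by simp at he; simp [he]))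
    (by rw [missing_reverse]; omega)
  refine ⟨N₁, N₂, hN₁, hN₂, fun x hx' y hy' => ?_⟩
  obtain ⟨a, a₁, a₂, rfl, hax, hax'⟩ := hx x hx'
  obtain ⟨b, b₁, b₂, rfl, hby, hby'⟩ := hy y hy'
  have hp' : p' = q.reverse.append (b₂.reverse.append b₁.reverse) := by
    rw [← p'.reverse_reverse, h']; simp
  rw [missing_append] at hm hm'
  refine ⟨a, b, a₁, a₂.append (q.reverse.append b₂.reverse), b₁.reverse, ?_, by omega,
    by rw [missing_reverse]; omega, ⟨hax, hax'⟩, ⟨hby, hby'⟩⟩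
  rw [hp']
  simp [SimpleGraph.Walk.append_assoc]

/-- One cheapest walk is completed for each pair of ends. -/
lemma exists_cheapest {ι : Type*} [Finite ι] (x y : ι → V) (b : ∀ i, G.graph.Walk (x i) (y i))
    (L : ℕ) (hL : ∀ i, missing H (b i) ≤ L) (R : Finset (V × V)) (hR : ∀ i, (x i, y i) ∈ R) :
    ∃ K ≤ G.graph, numEdges K ≤ R.card * L ∧
      ∀ i, G.Within (H ⊔ K) (x i) (y i) (G.len (b i)) := by
  have hone : ∀ c : V × V, ∃ K ≤ G.graph, numEdges K ≤ L ∧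
      ∀ i, (x i, y i) = c → G.Within (H ⊔ K) (x i) (y i) (G.len (b i)) := by
    intro c
    by_cases hc : {i | (x i, y i) = c}.Nonempty
    · obtain ⟨j, hj, hmin⟩ := Set.exists_min_image {i | (x i, y i) = c} (fun i => G.len (b i))
        (Set.toFinite _) hc
      refine ⟨patch H (b j), patch_le _, (numEdges_patch_le _).trans (hL j), fun i hi => ?_⟩
      have hij : (x i, y i) = (x j, y j) := hi.trans (Eq.symm hj)
      rw [Prod.mk.injEq] at hij
      have hw := (within_sup_patch (H := H) (b j)).mono (hmin i hi)
      generalize G.len (b i) = r at hw ⊢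
      rw [hij.1, hij.2]
      exact hw
    · exact ⟨⊥, bot_le, by simp [numEdges_bot], fun i hi => absurd ⟨i, hi⟩ hc⟩
  choose K hKG hK hw using hone
  exact ⟨R.sup K, Finset.sup_le fun c _ => hKG c, numEdges_finset_sup_le _ _ _ fun c _ => hK c,
    fun i => (hw _ i rfl).mono_graph (sup_le_sup_left (Finset.le_sup (hR i)) H)⟩

/-! ### Path buying -/

lemma patch_mono {p : K.Walk s t} {q : K.Walk u v} (h : ∀ e ∈ p.edges, e ∈ q.edges) :
    patch H p ≤ patch H q :=
  SimpleGraph.fromEdgeSet_mono fun e he => ⟨h e he.1, he.2⟩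

/-- If the `x`-`y` walk through `q` is not yet well approximated in `H`, then adding the edges of
`q` improves the distance of many pairs that contain `x` or `y` by at least `δ * ω`. -/
lemma IsLight.exists_improved {d : ℕ} {ω : ℝ≥0} (hL : G.IsLight H d) (hHG : H ≤ G.graph)
    {q : G.graph.Walk u v} (hq : G.IsShortest q) (hω : ∀ e ∈ q.edges, G.weight e ≤ ω)
    {x y : V} (hx : H.Adj u x) (hxω : G.weight s(u, x) ≤ ω) (hy : H.Adj v y)
    (hyω : G.weight s(v, y) ≤ ω) (δ : ℝ)
    (hn : ¬ G.Within H x y (G.weight s(u, x) + G.len q + G.weight s(v, y) + (2 + 2 * δ) * ω)) :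
    ∃ I : Finset (V × V), d * missing H q ≤ 3 * I.card ∧ ∀ c ∈ I, (c.1 = x ∨ c.1 = y) ∧
      G.graph.Reachable c.1 c.2 ∧ ∃ r : ℝ, ¬ G.Within H c.1 c.2 (r + δ * ω) ∧
        G.Within (H ⊔ patch H q) c.1 c.2 r ∧
        ∀ p : G.graph.Walk c.1 c.2, r ≤ G.len p + 4 * ω := by
  classical
  have hxω' : (G.weight s(u, x) : ℝ) ≤ ω := by exact_mod_cast hxω
  have hyω' : (G.weight s(v, y) : ℝ) ≤ ω := by exact_mod_cast hyω
  obtain ⟨N, hNc, hN⟩ := hL.exists_nearby hHG _ q hq hω rfl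
  have key : ∀ z : N, ∃ w : V, (w = x ∨ w = y) ∧ G.graph.Reachable w z ∧
      ∃ r : ℝ, ¬ G.Within H w z (r + δ * ω) ∧ G.Within (H ⊔ patch H q) w z r ∧
        ∀ p : G.graph.Walk w z, r ≤ G.len p + 4 * ω := by
    rintro ⟨z, hz⟩
    obtain ⟨a, r₁, r₂, rfl, ha, -, haω⟩ := hN z hz
    have haω' : (G.weight s(a, z) : ℝ) ≤ ω := by exact_mod_cast haω
    have hle : H ≤ H ⊔ patch H (r₁.append r₂) := le_sup_left
    have hr₁ : G.Within (H ⊔ patch H (r₁.append r₂)) u a (G.len r₁) :=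
      (within_sup_patch r₁).mono_graph (sup_le_sup_left (patch_mono fun e he => by simp [he]) _)
    have hr₂ : G.Within (H ⊔ patch H (r₁.append r₂)) a v (G.len r₂) :=
      (within_sup_patch r₂).mono_graph (sup_le_sup_left (patch_mono fun e he => by simp [he]) _)
    have haz := Within.of_adj (G := G) (hle ha)
    by_cases h1 : G.Within H x z (G.weight s(u, x) + G.len r₁ + G.weight s(a, z) + δ * ω)
    · have h2 : ¬ G.Within H y z (G.weight s(v, y) + G.len r₂ + G.weight s(a, z) + δ * ω) := by
        refine fun h2 => hn ((h1.trans h2.symm).mono ?_)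
        rw [len_append]
        linarith
      refine ⟨y, Or.inr rfl, ?_, _, h2, ?_, fun p => ?_⟩
      · exact (hHG hy.symm).reachable.trans (r₂.reverse.reachable.trans (hHG ha).reachable)
      · exact ((Within.of_adj (hle hy)).symm.trans hr₂.symm).trans haz
      · have := hq.right.reverse (.cons (hHG hy) (p.append (.cons (hHG ha).symm .nil)))
        rw [weight_swap a z] at haω' ⊢
        simp at this
        linarith
    · refine ⟨x, Or.inl rfl, ?_, _, h1, ?_, fun p => ?_⟩
      · exact (hHG hx.symm).reachable.trans (r₁.reachable.trans (hHG ha).reachable)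
      · exact ((Within.of_adj (hle hx)).symm.trans hr₁).trans haz
      · have := hq.left (.cons (hHG hx) (p.append (.cons (hHG ha).symm .nil)))
        rw [weight_swap a z] at haω' ⊢
        simp at this
        linarith
  choose w hw using key
  refine ⟨N.attach.image fun z => (w z, (z : V)), ?_, fun c hc => ?_⟩
  · rw [Finset.card_image_of_injective _ fun z z' h => Subtype.ext (Prod.mk.inj h).2,
      Finset.card_attach]
    exact hNc
  · obtain ⟨z, -, rfl⟩ := Finset.mem_image.1 hc
    exact hw z

/-- Path buying. The walks are considered in the order of increasing `ω`. A pair whose distance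
has been improved for the first time is then within `4 * ω` of its distance in `G`, and each
further improvement is by at least `δ * ω`, hence a pair is improved at most `1 + 4 / δ` times. -/
lemma IsLight.exists_path_buying [Fintype V] (π : G.ShortestPaths) {d : ℕ} (hL : G.IsLight H d)
    (hHG : H ≤ G.graph) (S : Finset V) {ι : Type*} (Q : Finset ι) (ω : ι → ℝ≥0) (x y u v : ι → V)
    (q : ∀ i, G.graph.Walk (u i) (v i)) (hq : ∀ i, G.IsShortest (q i))
    (hω : ∀ i, ∀ e ∈ (q i).edges, G.weight e ≤ ω i) (hxS : ∀ i, x i ∈ S) (hyS : ∀ i, y i ∈ S)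
    (hx : ∀ i, H.Adj (u i) (x i) ∧ G.weight s(u i, x i) ≤ ω i)
    (hy : ∀ i, H.Adj (v i) (y i) ∧ G.weight s(v i, y i) ≤ ω i) (δ : ℝ) (hδ : 0 < δ) :
    ∃ K ≤ G.graph, (d * numEdges K : ℝ) ≤ 3 * (S.card * Fintype.card V * (1 + 4 / δ)) ∧
      ∀ i ∈ Q, G.Within (H ⊔ K) (x i) (y i)
        (G.weight s(u i, x i) + G.len (q i) + G.weight s(v i, y i) + (2 + 2 * δ) * ω i) := by
  classical
  set M : ℝ := 1 + 4 / δ with hM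
  have hM1 : (M - 1) * δ = 4 := by rw [hM]; field_simp; ring
  have hM0 : 1 ≤ M := by rw [hM]; have : 0 < 4 / δ := by positivity
                         linarith
  -- `c (w, z)` counts the improvements of the distance from `w` to `z`.
  suffices h : ∃ K ≤ G.graph, ∃ c : V × V → ℕ,
      d * numEdges K ≤ 3 * ∑ e ∈ S ×ˢ Finset.univ, c e ∧ (∀ e, (c e : ℝ) ≤ M) ∧
      (∀ ρ : ℝ, (∀ i ∈ Q, (ω i : ℝ) ≤ ρ) → ∀ e, c e ≠ 0 → ∀ p : G.graph.Walk e.1 e.2,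
        G.Within (H ⊔ K) e.1 e.2 (G.len p + (M - c e) * δ * ρ)) ∧
      ∀ i ∈ Q, G.Within (H ⊔ K) (x i) (y i)
        (G.weight s(u i, x i) + G.len (q i) + G.weight s(v i, y i) + (2 + 2 * δ) * ω i) by
    obtain ⟨K, hKG, c, hK, hc, -, h⟩ := h
    refine ⟨K, hKG, ?_, h⟩
    have h1 : (∑ e ∈ S ×ˢ (Finset.univ : Finset V), (c e : ℝ)) ≤
        ∑ _e ∈ S ×ˢ (Finset.univ : Finset V), M := Finset.sum_le_sum fun e _ => hc e
    rw [Finset.sum_const, Finset.card_product, Finset.card_univ, nsmul_eq_mul] at h1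
    have h2 : (d * numEdges K : ℝ) ≤ 3 * ∑ e ∈ S ×ˢ (Finset.univ : Finset V), (c e : ℝ) := by
      exact_mod_cast hK
    push_cast at h1
    linarith
  induction Q using Finset.induction_on_max_value ω with
  | empty => exact ⟨⊥, bot_le, 0, by simp [numEdges_bot], fun e => by simpa using zero_le_one.trans hM0,
      by simp, by simp⟩
  | insert a Q haQ hmax ih =>
    obtain ⟨K, hKG, c, hK, hcM, hc, hQ⟩ := ih
    by_cases hn : G.Within (H ⊔ K) (x a) (y a)
        (G.weight s(u a, x a) + G.len (q a) + G.weight s(v a, y a) + (2 + 2 * δ) * ω a)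
    · refine ⟨K, hKG, c, hK, hcM, fun ρ hρ => hc ρ fun i hi => hρ i (Finset.mem_insert_of_mem hi),
        fun i hi => ?_⟩
      rcases Finset.mem_insert.1 hi with rfl | hi
      exacts [hn, hQ i hi]
    have hle : H ≤ H ⊔ K := le_sup_left
    obtain ⟨I, hI, himp⟩ := (hL.mono hle).exists_improved (sup_le hHG hKG) (hq a) (hω a)
      (hle (hx a).1) (hx a).2 (hle (hy a).1) (hy a).2 δ hn
    have hωa : (0 : ℝ) < ω a := by
      have h1 := G.weight_pos s(u a, x a) (hHG (hx a).1)
      exact_mod_cast h1.trans_le (hx a).2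
    have hmax' : ∀ i ∈ Q, (ω i : ℝ) ≤ ω a := fun i hi => by exact_mod_cast hmax i hi
    -- The bound on an improved pair, in terms of the increased count.
    have himp' : ∀ e ∈ I, ∀ p : G.graph.Walk e.1 e.2,
        G.Within ((H ⊔ K) ⊔ patch (H ⊔ K) (q a)) e.1 e.2
          (G.len p + (M - (c e + 1)) * δ * ω a) := by
      intro e he p
      obtain ⟨-, -, r, hr1, hr2, hr3⟩ := himp e he
      refine hr2.mono ?_
      by_cases hce : c e = 0
      · have := hr3 p
        rw [hce, Nat.cast_zero, zero_add, hM1]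
        linarith
      · by_contra! hlt
        refine hr1 ((hc (ω a) hmax' e hce p).mono ?_)
        nlinarith
    have hcM' : ∀ e ∈ I, (c e + 1 : ℝ) ≤ M := by
      intro e he
      obtain ⟨-, ⟨p₀⟩, -⟩ := himp e he
      by_contra! hlt
      have hp := π.isShortest ⟨p₀⟩
      obtain ⟨p', hp'⟩ := (himp' e he (π.path ⟨p₀⟩)).mono_graph
        (sup_le (sup_le hHG hKG) (patch_le _))
      have h1 := hp p'
      have h2 : (M - (c e + 1)) * δ * ω a < 0 := by
        have : 0 < δ * ω a := by positivity
        nlinarith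
      linarith
    refine ⟨K ⊔ patch (H ⊔ K) (q a), sup_le hKG (patch_le _),
      fun e => c e + if e ∈ I then 1 else 0, ?_, fun e => ?_, fun ρ hρ e hce p => ?_,
      fun i hi => ?_⟩
    · have h1 := numEdges_sup_le K (patch (H ⊔ K) (q a))
      have h2 := numEdges_patch_le (H := H ⊔ K) (q a)
      have hIS : I ⊆ S ×ˢ Finset.univ := by
        intro e he
        rw [Finset.mem_product]
        rcases (himp e he).1 with h | h <;> simp [h, hxS, hyS]
      rw [Finset.sum_add_distrib, Finset.sum_ite_mem, Finset.inter_eq_right.2 hIS]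
      simp only [Finset.sum_const, smul_eq_mul, mul_one]
      calc d * numEdges (K ⊔ patch (H ⊔ K) (q a))
          ≤ d * numEdges K + d * missing (H ⊔ K) (q a) := by
            rw [← mul_add]; exact Nat.mul_le_mul_left _ (by omega)
        _ ≤ _ := by linarith
    · by_cases he : e ∈ I
      · simpa [he] using hcM' e he
      · simpa [he] using hcM e
    · rw [← sup_assoc]
      have hρa : (ω a : ℝ) ≤ ρ := hρ a (Finset.mem_insert_self _ _)
      by_cases he : e ∈ I
      · refine (himp' e he p).mono ?_
        have h1 := hcM' e he
        simp only [he, if_true]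
        push_cast
        have : 0 ≤ (M - (c e + 1)) * δ := mul_nonneg (by linarith) hδ.le
        nlinarith
      · simp only [he, if_false, add_zero] at hce ⊢
        exact (hc ρ (fun i hi => hρ i (Finset.mem_insert_of_mem hi)) e hce p).mono_graph le_sup_left
    · rw [← sup_assoc]
      rcases Finset.mem_insert.1 hi with rfl | hi
      · have h1 : H ⊔ K ≤ (H ⊔ K) ⊔ patch (H ⊔ K) (q i) := le_sup_left
        have h2 := ((Within.of_adj (G := G) (h1 (hle (hx i).1))).symm.trans
          (within_sup_patch (H := H ⊔ K) (q i))).trans (Within.of_adj (h1 (hle (hy i).1)))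
        refine h2.mono ?_
        have : 0 ≤ (2 + 2 * δ) * ω i := by positivity
        linarith
      · exact (hQ i hi).mono_graph le_sup_left

/-! ### Spanners of most of the pairs -/

variable (G) in
/-- The vertex pairs that are joined by a path in `G`. -/
abbrev ConnectedPair : Type u := {i : V × V // G.graph.Reachable i.1 i.2}

/-- `H` approximates the distance of the pair `i` up to an error of `c` times the largest weight on
its chosen shortest path. -/
def ShortestPaths.Approx (π : G.ShortestPaths) (c : ℝ≥0) (H : SimpleGraph V)
    (i : G.ConnectedPair) : Prop :=
  G.Within H i.1.1 i.1.2 (G.len (π.path i.2) + c * π.W i.2)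

lemma ShortestPaths.Approx.mono {π : G.ShortestPaths} {c : ℝ≥0} {i : G.ConnectedPair}
    (h : π.Approx c H i) (hK : H ≤ K) : π.Approx c K i := h.mono_graph hK

/-- Pairs whose paths miss more than `L` edges: shortest path trees of few roots suffice for all
but a small fraction of them. -/
lemma IsLight.exists_trees_plus_two [Fintype V] (π : G.ShortestPaths) {d : ℕ} (hL : G.IsLight H d)
    (hHG : H ≤ G.graph) (Q : Finset G.ConnectedPair) (L j : ℕ)
    (hQ : ∀ i ∈ Q, L < missing H (π.path i.2)) :
    ∃ K ≤ G.graph, numEdges K ≤ j * Fintype.card V ∧ ∃ B ⊆ Q,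
      (B.card : ℝ) ≤ Real.exp (-(j * ((d * (L + 1) / 3 : ℝ) / Fintype.card V))) * Q.card ∧
      ∀ i ∈ Q, i ∉ B → π.Approx 2 (H ⊔ K) i := by
  classical
  choose N hNc hN using fun i : G.ConnectedPair =>
    hL.exists_nearby hHG _ (π.path i.2) (π.isShortest _) (weight_le_maxWeight _) rfl
  obtain ⟨R, hR, hRQ⟩ := exists_hitting Q N (d * (L + 1) / 3) (fun i hi => by
    have h1 : d * (L + 1) ≤ 3 * (N i).card :=
      (Nat.mul_le_mul_left d (hQ i hi)).trans (hNc i)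
    have h2 : (d * (L + 1) : ℝ) ≤ 3 * (N i).card := by exact_mod_cast h1
    linarith) j
  obtain ⟨T, hTG, hT, hTd⟩ := π.exists_trees R
  refine ⟨T, hTG, hT.trans (Nat.mul_le_mul_right _ hR), _, Finset.filter_subset _ Q, hRQ,
    fun i hi hiB => ?_⟩
  rw [Finset.mem_filter, not_and, Finset.not_disjoint_iff] at hiB
  obtain ⟨z, hz, hzR⟩ := hiB hi
  obtain ⟨v, r₁, r₂, hp, hv, -, hw⟩ := hN i z hz
  have hw' : (G.weight s(v, z) : ℝ) ≤ π.W i.2 := by exact_mod_cast hw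
  have h1 := hTd z hzR _ (.cons (hHG hv).symm r₁.reverse)
  have h2 := hTd z hzR _ (.cons (hHG hv).symm r₂)
  refine ((h1.symm.trans h2).mono_graph le_sup_right).mono ?_
  rw [hp]
  simp only [len_cons, len_reverse, len_append, weight_swap z v]
  push_cast
  linarith

/-- Few vertices contain the ends of a bridge for all but a small fraction of the pairs. -/
lemma IsLight.exists_bridge_ends [Fintype V] (π : G.ShortestPaths) {d : ℕ} (hL : G.IsLight H d)
    (hHG : H ≤ G.graph) (Q : Finset G.ConnectedPair) (k j : ℕ)
    (hQ : ∀ i ∈ Q, 2 * k < missing H (π.path i.2)) :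
    ∃ R₁ R₂ : Finset V, R₁.card ≤ j ∧ R₂.card ≤ j ∧ ∃ B ⊆ Q,
      (B.card : ℝ) ≤ 2 * Real.exp (-(j * ((d * (k + 1) / 6 : ℝ) / Fintype.card V))) * Q.card ∧
      ∀ i ∈ Q, i ∉ B → ∃ x ∈ R₁, ∃ y ∈ R₂, G.HasBridge H k (π.W i.2) (π.path i.2) x y := by
  classical
  have hex : ∀ i : G.ConnectedPair, ∃ N₁ N₂ : Finset V, i ∈ Q →
      d * (k + 1) ≤ 6 * N₁.card ∧ d * (k + 1) ≤ 6 * N₂.card ∧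
      ∀ x ∈ N₁, ∀ y ∈ N₂, G.HasBridge H k (π.W i.2) (π.path i.2) x y := by
    intro i
    by_cases hi : i ∈ Q
    · obtain ⟨N₁, N₂, h⟩ := hL.exists_hasBridge hHG (π.isShortest i.2)
        (weight_le_maxWeight _) (hQ i hi)
      exact ⟨N₁, N₂, fun _ => h⟩
    · exact ⟨∅, ∅, fun h => absurd h hi⟩
  choose N₁ N₂ hN using hex
  have hcast : ∀ m : ℕ, d * (k + 1) ≤ 6 * m → (d * (k + 1) / 6 : ℝ) ≤ m := by
    intro m hm
    have : (d * (k + 1) : ℝ) ≤ 6 * m := by exact_mod_cast hm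
    linarith
  obtain ⟨R₁, hR₁, hB₁⟩ := exists_hitting Q N₁ (d * (k + 1) / 6)
    (fun i hi => hcast _ (hN i hi).1) j
  obtain ⟨R₂, hR₂, hB₂⟩ := exists_hitting Q N₂ (d * (k + 1) / 6)
    (fun i hi => hcast _ (hN i hi).2.1) j
  refine ⟨R₁, R₂, hR₁, hR₂, (Q.filter fun i => Disjoint (N₁ i) R₁) ∪
    Q.filter fun i => Disjoint (N₂ i) R₂,
    Finset.union_subset (Finset.filter_subset _ _) (Finset.filter_subset _ _), ?_,
    fun i hi hiB => ?_⟩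
  · have : (((Q.filter fun i => Disjoint (N₁ i) R₁) ∪
        Q.filter fun i => Disjoint (N₂ i) R₂).card : ℝ) ≤
        (Q.filter fun i => Disjoint (N₁ i) R₁).card +
          (Q.filter fun i => Disjoint (N₂ i) R₂).card := by
      exact_mod_cast Finset.card_union_le _ _
    linarith
  · simp only [Finset.mem_union, Finset.mem_filter, hi, true_and, not_or,
      Finset.not_disjoint_iff] at hiB
    obtain ⟨⟨x, hx, hxR⟩, y, hy, hyR⟩ := hiB
    exact ⟨x, hxR, y, hyR, (hN i hi).2.2 x hx y hy⟩

/-- Completing the two ends of all the paths in `I` reduces the approximation of a pair to the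
approximation of the walk that its bridge takes between a vertex of `R₁` and one of `R₂`. -/
lemma exists_complete_ends (π : G.ShortestPaths)
    (I : Finset G.ConnectedPair) (k : ℕ) (R₁ R₂ : Finset V)
    (hI : ∀ i ∈ I, ∃ x ∈ R₁, ∃ y ∈ R₂, G.HasBridge H k (π.W i.2) (π.path i.2) x y) :
    ∃ K ≤ G.graph, numEdges K ≤ 2 * (I.card * k) ∧
    ∃ (x y u v : I → V) (q : ∀ i, G.graph.Walk (u i) (v i)), (∀ i, x i ∈ R₁) ∧ (∀ i, y i ∈ R₂) ∧
      (∀ i, G.IsShortest (q i)) ∧ (∀ i, ∀ e ∈ (q i).edges, G.weight e ≤ π.W i.1.2) ∧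
      (∀ i, missing H (q i) ≤ missing H (π.path i.1.2)) ∧
      (∀ i, H.Adj (u i) (x i) ∧ G.weight s(u i, x i) ≤ π.W i.1.2) ∧
      (∀ i, H.Adj (v i) (y i) ∧ G.weight s(v i, y i) ≤ π.W i.1.2) ∧
      ∀ (i : I) (K' : SimpleGraph V) (c r : ℝ≥0), 4 + r ≤ c →
        G.Within (H ⊔ K') (x i) (y i) (G.weight s(u i, x i) + G.len (q i) +
          G.weight s(v i, y i) + r * π.W i.1.2) → π.Approx c (H ⊔ (K ⊔ K')) i.1 := by
  classical
  have hI' : ∀ i : I, ∃ x ∈ R₁, ∃ y ∈ R₂, G.HasBridge H k (π.W i.1.2) (π.path i.1.2) x y :=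
    fun i => hI i.1 i.2
  choose x hx y hy u v p₁ q p₂ hp hm₁ hm₂ hux hvy using hI'
  obtain ⟨K₁, hKG₁, hK₁, hw₁⟩ := exists_patch_family Finset.univ _ _ p₁ k fun i _ => hm₁ i
  obtain ⟨K₂, hKG₂, hK₂, hw₂⟩ := exists_patch_family Finset.univ _ _ p₂ k fun i _ => hm₂ i
  have hq : ∀ i, ∀ e ∈ (q i).edges, e ∈ (π.path i.1.2).edges := fun i e he => by
    rw [hp i]; simp [he]
  refine ⟨K₁ ⊔ K₂, sup_le hKG₁ hKG₂, ?_, x, y, u, v, q, hx, hy, fun i => ?_,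
    fun i e he => weight_le_maxWeight _ _ (hq i e he), fun i => ?_, hux, hvy,
    fun i K' c r hc hw => ?_⟩
  · have := numEdges_sup_le K₁ K₂
    rw [Finset.card_univ, Fintype.card_coe] at hK₁ hK₂
    omega
  · have := π.isShortest i.1.2
    rw [hp i] at this
    exact this.middle
  · rw [hp i, missing_append, missing_append]
    omega
  · set L := H ⊔ (K₁ ⊔ K₂ ⊔ K') with hL
    have e0 : H ≤ L := le_sup_left
    have e1 : H ⊔ K₁ ≤ L := sup_le_sup_left (le_sup_left.trans le_sup_left) _
    have e2 : H ⊔ K₂ ≤ L := sup_le_sup_left (le_sup_right.trans le_sup_left) _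
    have e3 : H ⊔ K' ≤ L := sup_le_sup_left le_sup_right _
    have h1 := (hw₁ i (Finset.mem_univ _)).mono_graph e1
    have h2 := (hw₂ i (Finset.mem_univ _)).mono_graph e2
    have h3 := Within.of_adj (G := G) (e0 (hux i).1)
    have h4 := (Within.of_adj (G := G) (e0 (hvy i).1)).symm
    refine ((((h1.trans h3).trans (hw.mono_graph e3)).trans h4).trans h2).mono ?_
    have h5 : (G.weight s(u i, x i) : ℝ) ≤ π.W i.1.2 := by exact_mod_cast (hux i).2
    have h6 : (G.weight s(v i, y i) : ℝ) ≤ π.W i.1.2 := by exact_mod_cast (hvy i).2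
    have h7 : ((4 + r : ℝ≥0) : ℝ) * π.W i.1.2 ≤ c * π.W i.1.2 := by
      exact_mod_cast mul_le_mul_left hc _
    have h8 : G.len (π.path i.1.2) = G.len (p₁ i) + (G.len (q i) + G.len (p₂ i)) := by
      conv_lhs => rw [hp i]
      simp only [len_append]
    push_cast at h7
    rw [h8]
    linarith

/-- Pairs whose paths miss at most `k` edges. -/
lemma exists_patch_short (π : G.ShortestPaths) (c : ℝ≥0) (Q : Finset G.ConnectedPair) (k : ℕ)
    (hk : ∀ i ∈ Q, missing H (π.path i.2) ≤ k) :
    ∃ K ≤ G.graph, numEdges K ≤ Q.card * k ∧ ∀ i ∈ Q, π.Approx c (H ⊔ K) i := by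
  obtain ⟨K, hKG, hK, hw⟩ := exists_patch_family Q _ _ (fun i => π.path i.2) k hk
  exact ⟨K, hKG, hK, fun i hi => (hw i hi).mono (by
    have : (0 : ℝ) ≤ c * π.W i.2 := by positivity
    linarith)⟩

/-- Paths with at most `k` missing edges are completed, and shortest path trees serve the rest. -/
theorem ShortestPaths.exists_plus_two [Fintype V] (π : G.ShortestPaths)
    (Q : Finset G.ConnectedPair) (d k j : ℕ) :
    ∃ H ≤ G.graph, numEdges H ≤ Fintype.card V * d + Q.card * k + j * Fintype.card V ∧ ∃ B ⊆ Q,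
      (B.card : ℝ) ≤ Real.exp (-(j * ((d * (k + 1) / 3 : ℝ) / Fintype.card V))) * Q.card ∧
      ∀ i ∈ Q, i ∉ B → π.Approx 2 H i := by
  classical
  obtain ⟨H, hHG, hH, hL⟩ := G.exists_isLight d
  obtain ⟨K₁, hKG₁, hK₁, h₁⟩ := exists_patch_short π 2
    (Q.filter fun i => missing H (π.path i.2) ≤ k) k fun i hi => (Finset.mem_filter.1 hi).2
  obtain ⟨K₂, hKG₂, hK₂, B, hBQ, hB, h₂⟩ := hL.exists_trees_plus_two π hHG
    (Q.filter fun i => k < missing H (π.path i.2)) k j fun i hi => (Finset.mem_filter.1 hi).2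
  refine ⟨H ⊔ (K₁ ⊔ K₂), sup_le hHG (sup_le hKG₁ hKG₂), ?_, B,
    hBQ.trans (Finset.filter_subset _ _), hB.trans ?_, fun i hi hiB => ?_⟩
  · have h1 := numEdges_sup_le H (K₁ ⊔ K₂)
    have h2 := numEdges_sup_le K₁ K₂
    have h3 := Nat.mul_le_mul_right k
      (Finset.card_filter_le Q fun i => missing H (π.path i.2) ≤ k)
    omega
  · gcongr; exact Finset.filter_subset _ _
  · rcases le_or_gt (missing H (π.path i.2)) k with h | h
    · exact (h₁ i (Finset.mem_filter.2 ⟨hi, h⟩)).mono (sup_le_sup_left le_sup_left _)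
    · exact (h₂ i (Finset.mem_filter.2 ⟨hi, h⟩) hiB).mono (sup_le_sup_left le_sup_right _)

/-- Paths with more than `L` missing edges are served by shortest path trees, those with more than
`2 * k` by cheapest walks between the ends of bridges. -/
theorem ShortestPaths.exists_plus_four [Fintype V] (π : G.ShortestPaths)
    (Q : Finset G.ConnectedPair) (d k L j₁ j₂ : ℕ) :
    ∃ H ≤ G.graph, numEdges H ≤ Fintype.card V * d + 4 * (Q.card * k) + j₁ * Fintype.card V +
        j₂ * j₂ * L ∧ ∃ B ⊆ Q,
      (B.card : ℝ) ≤ (Real.exp (-(j₁ * ((d * (L + 1) / 3 : ℝ) / Fintype.card V))) +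
        2 * Real.exp (-(j₂ * ((d * (k + 1) / 6 : ℝ) / Fintype.card V)))) * Q.card ∧
      ∀ i ∈ Q, i ∉ B → π.Approx 4 H i := by
  classical
  obtain ⟨H, hHG, hH, hL⟩ := G.exists_isLight d
  let m : G.ConnectedPair → ℕ := fun i => missing H (π.path i.2)
  obtain ⟨K₁, hKG₁, hK₁, h₁⟩ := exists_patch_short π 4 (Q.filter fun i => m i ≤ 2 * k) (2 * k)
    fun i hi => (Finset.mem_filter.1 hi).2
  obtain ⟨K₂, hKG₂, hK₂, B₂, hBQ₂, hB₂, h₂⟩ := hL.exists_trees_plus_two π hHG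
    (Q.filter fun i => L < m i) L j₁ fun i hi => (Finset.mem_filter.1 hi).2
  set M := Q.filter fun i => 2 * k < m i ∧ m i ≤ L with hM
  obtain ⟨R₁, R₂, hR₁, hR₂, B₃, hBM, hB₃, hbr⟩ := hL.exists_bridge_ends π hHG M k j₂
    fun i hi => (Finset.mem_filter.1 hi).2.1
  obtain ⟨K₃, hKG₃, hK₃, x, y, u, v, q, hx, hy, -, -, hqm, hux, hvy, h₃⟩ :=
    exists_complete_ends π (M \ B₃) k R₁ R₂ fun i hi =>
      hbr i (Finset.mem_sdiff.1 hi).1 (Finset.mem_sdiff.1 hi).2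
  obtain ⟨K₄, hKG₄, hK₄, h₄⟩ := exists_cheapest (H := H) x y
    (fun i => .cons (hHG (hux i).1.symm) ((q i).append (.cons (hHG (hvy i).1) .nil))) L
    (fun i => by
      rw [missing_cons_of_adj _ _ (hux i).1.symm, missing_append,
        missing_cons_of_adj _ _ (hvy i).1, missing_nil, add_zero]
      exact (hqm i).trans (Finset.mem_filter.1 (Finset.mem_sdiff.1 i.2).1).2.2)
    (R₁ ×ˢ R₂) fun i => Finset.mem_product.2 ⟨hx i, hy i⟩
  refine ⟨H ⊔ (K₁ ⊔ (K₂ ⊔ (K₃ ⊔ K₄))),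
    sup_le hHG (sup_le hKG₁ (sup_le hKG₂ (sup_le hKG₃ hKG₄))), ?_, B₂ ∪ B₃,
    Finset.union_subset (hBQ₂.trans (Finset.filter_subset _ _))
      (hBM.trans (Finset.filter_subset _ _)), ?_, fun i hi hiB => ?_⟩
  · have e1 := numEdges_sup_le H (K₁ ⊔ (K₂ ⊔ (K₃ ⊔ K₄)))
    have e2 := numEdges_sup_le K₁ (K₂ ⊔ (K₃ ⊔ K₄))
    have e3 := numEdges_sup_le K₂ (K₃ ⊔ K₄)
    have e4 := numEdges_sup_le K₃ K₄
    have e5 : (Q.filter fun i => m i ≤ 2 * k).card * (2 * k) ≤ Q.card * (2 * k) :=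
      Nat.mul_le_mul_right _ (Finset.card_filter_le _ _)
    have e6 : (M \ B₃).card * k ≤ Q.card * k :=
      Nat.mul_le_mul_right _ ((Finset.card_le_card Finset.sdiff_subset).trans
        (Finset.card_filter_le _ _))
    have e7 : (R₁ ×ˢ R₂).card * L ≤ j₂ * j₂ * L := by
      rw [Finset.card_product]; gcongr
    have e8 : Q.card * (2 * k) = 2 * (Q.card * k) := by ring
    omega
  · have e1 : ((B₂ ∪ B₃).card : ℝ) ≤ B₂.card + B₃.card := by
      exact_mod_cast Finset.card_union_le _ _
    rw [add_mul]
    refine e1.trans (add_le_add (hB₂.trans ?_) (hB₃.trans ?_)) <;>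
    · gcongr; exact Finset.filter_subset _ _
  · rw [Finset.mem_union, not_or] at hiB
    rcases le_or_gt (m i) (2 * k) with h | h
    · exact (h₁ i (Finset.mem_filter.2 ⟨hi, h⟩)).mono (sup_le_sup_left le_sup_left _)
    rcases lt_or_ge L (m i) with h' | h'
    · exact Within.mono ((h₂ i (Finset.mem_filter.2 ⟨hi, h'⟩) hiB.1).mono
        (sup_le_sup_left (le_sup_left.trans le_sup_right) _)) (by gcongr; norm_num)
    have hiM : i ∈ M \ B₃ := Finset.mem_sdiff.2 ⟨Finset.mem_filter.2 ⟨hi, h, h'⟩, hiB.2⟩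
    refine (h₃ ⟨i, hiM⟩ K₄ 4 0 (by simp) ((h₄ ⟨i, hiM⟩).mono ?_)).mono
      (sup_le_sup_left (le_sup_right.trans le_sup_right) _)
    simp only [len_cons, len_append, len_nil, weight_swap (x _) (u _)]
    push_cast
    linarith

/-- The walks between the ends of bridges are approximated by path buying. -/
theorem ShortestPaths.exists_plus_six [Fintype V] (π : G.ShortestPaths) (ε : ℝ≥0) (hε : 0 < ε)
    (Q : Finset G.ConnectedPair) (d k j : ℕ) :
    ∃ H ≤ G.graph, (∃ b : ℕ, numEdges H ≤ Fintype.card V * d + 4 * (Q.card * k) + b ∧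
        (d * b : ℝ) ≤ 3 * (2 * j * Fintype.card V * (1 + 8 / ε))) ∧ ∃ B ⊆ Q,
      (B.card : ℝ) ≤
        2 * Real.exp (-(j * ((d * (k + 1) / 6 : ℝ) / Fintype.card V))) * Q.card ∧
      ∀ i ∈ Q, i ∉ B → π.Approx (6 + ε) H i := by
  classical
  obtain ⟨H, hHG, hH, hL⟩ := G.exists_isLight d
  let m : G.ConnectedPair → ℕ := fun i => missing H (π.path i.2)
  obtain ⟨K₁, hKG₁, hK₁, h₁⟩ := exists_patch_short π (6 + ε) (Q.filter fun i => m i ≤ 2 * k)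
    (2 * k) fun i hi => (Finset.mem_filter.1 hi).2
  set M := Q.filter fun i => 2 * k < m i with hM
  obtain ⟨R₁, R₂, hR₁, hR₂, B, hBM, hB, hbr⟩ := hL.exists_bridge_ends π hHG M k j
    fun i hi => (Finset.mem_filter.1 hi).2
  obtain ⟨K₃, hKG₃, hK₃, x, y, u, v, q, hx, hy, hqs, hqω, -, hux, hvy, h₃⟩ :=
    exists_complete_ends π (M \ B) k R₁ R₂ fun i hi =>
      hbr i (Finset.mem_sdiff.1 hi).1 (Finset.mem_sdiff.1 hi).2
  obtain ⟨K₄, hKG₄, hK₄, h₄⟩ := hL.exists_path_buying π hHG (R₁ ∪ R₂) Finset.univ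
    (fun i : ↥(M \ B) => π.W i.1.2) x y u v q hqs hqω (fun i => Finset.mem_union_left _ (hx i))
    (fun i => Finset.mem_union_right _ (hy i)) hux hvy (ε / 2) (by positivity)
  refine ⟨H ⊔ (K₁ ⊔ (K₃ ⊔ K₄)), sup_le hHG (sup_le hKG₁ (sup_le hKG₃ hKG₄)),
    ⟨numEdges K₄, ?_, hK₄.trans ?_⟩, B, hBM.trans (Finset.filter_subset _ _), hB.trans ?_,
    fun i hi hiB => ?_⟩
  · have e1 := numEdges_sup_le H (K₁ ⊔ (K₃ ⊔ K₄))
    have e2 := numEdges_sup_le K₁ (K₃ ⊔ K₄)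
    have e4 := numEdges_sup_le K₃ K₄
    have e5 : (Q.filter fun i => m i ≤ 2 * k).card * (2 * k) ≤ Q.card * (2 * k) :=
      Nat.mul_le_mul_right _ (Finset.card_filter_le _ _)
    have e6 : (M \ B).card * k ≤ Q.card * k :=
      Nat.mul_le_mul_right _ ((Finset.card_le_card Finset.sdiff_subset).trans
        (Finset.card_filter_le _ _))
    have e8 : Q.card * (2 * k) = 2 * (Q.card * k) := by ring
    omega
  · have e1 : ((R₁ ∪ R₂).card : ℝ) ≤ 2 * j := by
      have := Finset.card_union_le R₁ R₂
      exact_mod_cast this.trans (by omega)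
    have e2 : (4 : ℝ) / (ε / 2) = 8 / ε := by field_simp; norm_num
    rw [e2]
    gcongr
  · gcongr; exact Finset.filter_subset _ _
  · rcases le_or_gt (m i) (2 * k) with h | h
    · exact (h₁ i (Finset.mem_filter.2 ⟨hi, h⟩)).mono (sup_le_sup_left le_sup_left _)
    have hiM : i ∈ M \ B := Finset.mem_sdiff.2 ⟨Finset.mem_filter.2 ⟨hi, h⟩, hiB⟩
    refine (h₃ ⟨i, hiM⟩ K₄ (6 + ε) (2 + ε) (by rw [← add_assoc]; norm_num)
      ((h₄ ⟨i, hiM⟩ (Finset.mem_univ _)).mono ?_)).mono (sup_le_sup_left le_sup_right _)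
    push_cast
    linarith

/-! ### From most pairs to all pairs -/

/-- If a quarter of any set of pairs can be served by `C * n * |Q| ^ α` edges, then all pairs can be
served by iterating on the remaining ones: the costs form a geometric series. -/
lemma ShortestPaths.exists_approx_all [Fintype V] (π : G.ShortestPaths) (c : ℝ≥0) {α C : ℝ}
    (hα : 0 < α)
    (h : ∀ Q : Finset G.ConnectedPair, Q.Nonempty → ∃ H ≤ G.graph,
      (numEdges H : ℝ) ≤ C * (Fintype.card V * (Q.card : ℝ) ^ α) ∧
      ∃ B ⊆ Q, (B.card : ℝ) ≤ 3 / 4 * Q.card ∧ ∀ i ∈ Q, i ∉ B → π.Approx c H i)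
    (hC : 0 ≤ C) (Q : Finset G.ConnectedPair) :
    ∃ H ≤ G.graph,
      (numEdges H : ℝ) ≤ C / (1 - (3 / 4) ^ α) * (Fintype.card V * (Q.card : ℝ) ^ α) ∧
      ∀ i ∈ Q, π.Approx c H i := by
  have hθ : ((3 : ℝ) / 4) ^ α < 1 := Real.rpow_lt_one (by norm_num) (by norm_num) hα
  induction Q using Finset.strongInduction with
  | H Q ih =>
  rcases Q.eq_empty_or_nonempty with rfl | hne
  · exact ⟨⊥, bot_le, by simp [numEdges_bot, Real.zero_rpow hα.ne'], by simp⟩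
  obtain ⟨H, hHG, hH, B, hBQ, hB, happ⟩ := h Q hne
  have hQ0 : (0 : ℝ) < Q.card := by exact_mod_cast hne.card_pos
  have hss : B ⊂ Q := by
    refine Finset.ssubset_iff_subset_ne.2 ⟨hBQ, ?_⟩
    rintro rfl
    linarith
  obtain ⟨K, hKG, hK, happ'⟩ := ih B hss
  refine ⟨H ⊔ K, sup_le hHG hKG, ?_, fun i hi => ?_⟩
  · have h1 : (numEdges (H ⊔ K) : ℝ) ≤ numEdges H + numEdges K := by
      exact_mod_cast numEdges_sup_le H K
    have h2 : (B.card : ℝ) ^ α ≤ (3 / 4) ^ α * (Q.card : ℝ) ^ α := by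
      rw [← Real.mul_rpow (by norm_num) hQ0.le]
      exact Real.rpow_le_rpow (by positivity) hB hα.le
    have h3 : C / (1 - (3 / 4) ^ α) * (Fintype.card V * (B.card : ℝ) ^ α) ≤
        C / (1 - (3 / 4) ^ α) * (Fintype.card V * ((3 / 4) ^ α * (Q.card : ℝ) ^ α)) := by
      have : 0 ≤ C / (1 - (3 / 4) ^ α) := div_nonneg hC (by linarith)
      gcongr
    have h4 : C * (Fintype.card V * (Q.card : ℝ) ^ α) +
        C / (1 - (3 / 4) ^ α) * (Fintype.card V * ((3 / 4) ^ α * (Q.card : ℝ) ^ α)) =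
        C / (1 - (3 / 4) ^ α) * (Fintype.card V * (Q.card : ℝ) ^ α) := by
      have : (1 - ((3 : ℝ) / 4) ^ α) ≠ 0 := by linarith
      field_simp
      ring
    linarith
  · by_cases hiB : i ∈ B
    · exact (happ' i hiB).mono le_sup_right
    · exact (happ i hi hiB).mono le_sup_left

lemma isPairwiseSpanner_of_approx {π : G.ShortestPaths} {c : ℝ≥0} {P : Set (V × V)}
    (hHG : H ≤ G.graph) (h : ∀ i : G.ConnectedPair, i.1 ∈ P → π.Approx c H i) :
    IsPairwiseSpanner π c P H := by
  refine ⟨hHG, fun s t hst hr => ?_⟩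
  obtain ⟨p, hp⟩ := h ⟨(s, t), hr⟩ hst
  have hp' : G.length p ≤ G.length (π.path hr) + c * π.W hr := by exact_mod_cast hp
  rw [← π.shortest hr]
  exact (iInf_le _ p).trans (by exact_mod_cast hp')

lemma IsPairwiseSpanner.mono {π : G.ShortestPaths} {c c' : ℝ≥0} {P : Set (V × V)}
    (h : IsPairwiseSpanner π c P H) (hc : c ≤ c') : IsPairwiseSpanner π c' P H :=
  ⟨h.subgraph, fun s t hst hr => (h.dist_le s t hst hr).trans (by gcongr)⟩

lemma ShortestPaths.exists_pairwiseSpanner [Fintype V] (π : G.ShortestPaths) (c : ℝ≥0) {α C : ℝ}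
    (hα : 0 < α) (hC : 0 ≤ C)
    (h : ∀ Q : Finset G.ConnectedPair, Q.Nonempty → ∃ H ≤ G.graph,
      (numEdges H : ℝ) ≤ C * (Fintype.card V * (Q.card : ℝ) ^ α) ∧
      ∃ B ⊆ Q, (B.card : ℝ) ≤ 3 / 4 * Q.card ∧ ∀ i ∈ Q, i ∉ B → π.Approx c H i)
    (P : Finset (V × V)) :
    ∃ H, IsPairwiseSpanner π c (P : Set (V × V)) H ∧ (H.edgeSet.ncard : ℝ) ≤
      C / (1 - (3 / 4) ^ α) * (Fintype.card V * (P.card : ℝ) ^ α) := by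
  classical
  obtain ⟨H, hHG, hH, happ⟩ := π.exists_approx_all c hα h hC (P.subtype _)
  refine ⟨H, isPairwiseSpanner_of_approx hHG fun i hi => happ i (by simpa using hi),
    hH.trans ?_⟩
  have h1 : ((P.subtype fun i => G.graph.Reachable i.1 i.2).card : ℝ) ≤ P.card := by
    rw [Finset.card_subtype]
    exact_mod_cast Finset.card_filter_le _ _
  have hθ : ((3 : ℝ) / 4) ^ α < 1 := Real.rpow_lt_one (by norm_num) (by norm_num) hα
  have : 0 ≤ C / (1 - (3 / 4) ^ α) := div_nonneg hC (by linarith)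
  gcongr

/-! ### The choice of the parameters -/

lemma exp_neg_le_quarter {x : ℝ} (hx : 2 ≤ x) : Real.exp (-x) ≤ 1 / 4 := by
  have h1 : (2 : ℝ) ≤ Real.exp 1 := by have := Real.add_one_le_exp (1 : ℝ); linarith
  have h2 : (4 : ℝ) ≤ Real.exp x := by
    calc (4 : ℝ) ≤ Real.exp 1 * Real.exp 1 := by nlinarith
      _ = Real.exp 2 := by rw [← Real.exp_add]; norm_num
      _ ≤ _ := Real.exp_le_exp.2 hx
  rw [Real.exp_neg, one_div]
  exact inv_anti₀ (by norm_num) h2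

lemma rpow_one_div_pow {p : ℝ} (hp : 0 ≤ p) (m k : ℕ) :
    (p ^ (1 / m : ℝ)) ^ k = p ^ (k / m : ℝ) := by
  rw [← Real.rpow_natCast, ← Real.rpow_mul hp]
  congr 1
  ring

lemma ceil_le_add {x y : ℝ} (hx : 0 ≤ x) (hy : 1 ≤ y) : (⌈x⌉₊ : ℝ) ≤ x + y :=
  (Nat.ceil_lt_add_one hx).le.trans (by linarith)

lemma card_pos_of_pairs [Fintype V] {Q : Finset G.ConnectedPair} (hQ : Q.Nonempty) :
    (0 : ℝ) < Fintype.card V := by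
  obtain ⟨i, -⟩ := hQ
  have : Nonempty V := ⟨i.1.1⟩
  exact_mod_cast Fintype.card_pos

/-- The fraction of pairs that are not hit is small if `j` is at least `2 * n / μ`, where `μ` is a
lower bound on the size of the sets. -/
lemma exp_hit_le {n j d k f : ℝ} (hn : 0 < n) {A D E : ℝ} (hD : 0 ≤ D)
    (hE : 0 ≤ E) (hA : 0 ≤ A) (hj : A ≤ j) (hd : D ≤ d) (hk : E ≤ k) (hf : 0 < f)
    (h : 2 * (f * n) ≤ A * (D * E)) : Real.exp (-(j * ((d * k / f) / n))) ≤ 1 / 4 := by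
  apply exp_neg_le_quarter
  have h1 : A * (D * E) ≤ j * (d * k) :=
    mul_le_mul hj (mul_le_mul hd hk hE (hD.trans hd)) (mul_nonneg hD hE) (hA.trans hj)
  rw [div_div, mul_div_assoc', le_div_iff₀ (by positivity)]
  linarith

/-- With `|Q| = a ^ 3`, the parameters are `d = a`, `k = n / a ^ 2` and `6 * a` roots. Here `k` is
rounded down, possibly to `0`, since `Q.card * k` edges are paid for it, whereas the size of the
neighbourhoods involves `k + 1`. -/
theorem ShortestPaths.exists_most_plus_two [Fintype V] (π : G.ShortestPaths)
    (Q : Finset G.ConnectedPair) (hQ : Q.Nonempty) : ∃ H ≤ G.graph,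
      (numEdges H : ℝ) ≤ 10 * (Fintype.card V * (Q.card : ℝ) ^ (1 / 3 : ℝ)) ∧
      ∃ B ⊆ Q, (B.card : ℝ) ≤ 3 / 4 * Q.card ∧ ∀ i ∈ Q, i ∉ B → π.Approx 2 H i := by
  have hn := card_pos_of_pairs hQ
  have hp : (1 : ℝ) ≤ Q.card := by exact_mod_cast hQ.card_pos
  set n : ℝ := (Fintype.card V : ℝ) with hn'
  set a : ℝ := (Q.card : ℝ) ^ (1 / 3 : ℝ) with ha
  have ha1 : 1 ≤ a := Real.one_le_rpow hp (by norm_num)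
  have ha3 : a ^ 3 = Q.card := by
    have := rpow_one_div_pow (p := Q.card) (by positivity) 3 3
    simpa [ha] using this
  obtain ⟨H, hHG, hH, B, hBQ, hB, happ⟩ := π.exists_plus_two Q ⌈a⌉₊ ⌊n / a ^ 2⌋₊ ⌈6 * a⌉₊
  have hd := ceil_le_add (x := a) (by positivity) ha1
  have hk := Nat.floor_le (a := n / a ^ 2) (by positivity)
  have hj := ceil_le_add (x := 6 * a) (by positivity) ha1
  refine ⟨H, hHG, ?_, B, hBQ, hB.trans ?_, happ⟩
  · have h1 := (Nat.cast_le (α := ℝ)).2 hH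
    push_cast at h1
    rw [← ha3, ← hn'] at h1
    calc (numEdges H : ℝ) ≤ n * (a + a) + a ^ 3 * (n / a ^ 2) + (6 * a + a) * n :=
          h1.trans (by gcongr)
      _ = 10 * (n * a) := by field_simp; ring
  · have := exp_hit_le hn (A := 6 * a) (D := a) (E := n / a ^ 2) (by positivity) (by positivity)
      (by positivity) (Nat.le_ceil _) (Nat.le_ceil _) (Nat.lt_floor_add_one _).le three_pos
      (le_of_eq (by field_simp; ring))
    gcongr
    linarith

/-- With `|Q| = a ^ 7`, the parameters are `d = a ^ 2`, `k = n / a ^ 5`, `L = n / a ^ 4`, `6 * a ^ 2`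
roots, and `12 * a ^ 3` ends of bridges on either side. -/
theorem ShortestPaths.exists_most_plus_four [Fintype V] (π : G.ShortestPaths)
    (Q : Finset G.ConnectedPair) (hQ : Q.Nonempty) : ∃ H ≤ G.graph,
      (numEdges H : ℝ) ≤ 182 * (Fintype.card V * (Q.card : ℝ) ^ (2 / 7 : ℝ)) ∧
      ∃ B ⊆ Q, (B.card : ℝ) ≤ 3 / 4 * Q.card ∧ ∀ i ∈ Q, i ∉ B → π.Approx 4 H i := by
  have hn := card_pos_of_pairs hQ
  have hp : (1 : ℝ) ≤ Q.card := by exact_mod_cast hQ.card_pos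
  set n : ℝ := (Fintype.card V : ℝ) with hn'
  set a : ℝ := (Q.card : ℝ) ^ (1 / 7 : ℝ) with ha
  have ha1 : 1 ≤ a := Real.one_le_rpow hp (by norm_num)
  have ha7 : a ^ 7 = Q.card := by
    have := rpow_one_div_pow (p := Q.card) (by positivity) 7 7
    simpa [ha] using this
  have ha2 : (Q.card : ℝ) ^ (2 / 7 : ℝ) = a ^ 2 := by
    have := rpow_one_div_pow (p := Q.card) (by positivity) 7 2
    simpa [ha] using this.symm
  obtain ⟨H, hHG, hH, B, hBQ, hB, happ⟩ :=
    π.exists_plus_four Q ⌈a ^ 2⌉₊ ⌊n / a ^ 5⌋₊ ⌊n / a ^ 4⌋₊ ⌈6 * a ^ 2⌉₊ ⌈12 * a ^ 3⌉₊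
  have hd := ceil_le_add (x := a ^ 2) (by positivity) (one_le_pow₀ ha1 (n := 2))
  have hk := Nat.floor_le (a := n / a ^ 5) (by positivity)
  have hL := Nat.floor_le (a := n / a ^ 4) (by positivity)
  have hj₁ := ceil_le_add (x := 6 * a ^ 2) (by positivity) (one_le_pow₀ ha1 (n := 2))
  have hj₂ := ceil_le_add (x := 12 * a ^ 3) (by positivity) (one_le_pow₀ ha1 (n := 3))
  refine ⟨H, hHG, ?_, B, hBQ, hB.trans ?_, happ⟩
  · have h1 := (Nat.cast_le (α := ℝ)).2 hH
    push_cast at h1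
    rw [← ha7, ← hn'] at h1
    rw [ha2]
    calc (numEdges H : ℝ) ≤ n * (a ^ 2 + a ^ 2) + 4 * (a ^ 7 * (n / a ^ 5)) +
          (6 * a ^ 2 + a ^ 2) * n +
          (12 * a ^ 3 + a ^ 3) * (12 * a ^ 3 + a ^ 3) * (n / a ^ 4) := h1.trans (by gcongr)
      _ = 182 * (n * a ^ 2) := by field_simp; ring
  · have h1 := exp_hit_le hn (A := 6 * a ^ 2) (D := a ^ 2) (E := n / a ^ 4) (by positivity)
      (by positivity) (by positivity) (Nat.le_ceil _) (Nat.le_ceil _) (Nat.lt_floor_add_one _).le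
      three_pos (le_of_eq (by field_simp; ring))
    have h2 := exp_hit_le hn (A := 12 * a ^ 3) (D := a ^ 2) (E := n / a ^ 5) (by positivity)
      (by positivity) (by positivity) (Nat.le_ceil _) (Nat.le_ceil _) (Nat.lt_floor_add_one _).le
      (f := 6) (by norm_num) (le_of_eq (by field_simp; ring))
    gcongr
    linarith

/-- With `|Q| = a ^ 4`, the parameters are `d = a`, `k = n / a ^ 3`, and `12 * a ^ 2` ends of bridges
on either side. -/
theorem ShortestPaths.exists_most_plus_six [Fintype V] (π : G.ShortestPaths) (ε : ℝ≥0)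
    (hε : 0 < ε) (Q : Finset G.ConnectedPair) (hQ : Q.Nonempty) : ∃ H ≤ G.graph,
      (numEdges H : ℝ) ≤ (84 + 624 / ε) * (Fintype.card V * (Q.card : ℝ) ^ (1 / 4 : ℝ)) ∧
      ∃ B ⊆ Q, (B.card : ℝ) ≤ 3 / 4 * Q.card ∧ ∀ i ∈ Q, i ∉ B → π.Approx (6 + ε) H i := by
  have hn := card_pos_of_pairs hQ
  have hp : (1 : ℝ) ≤ Q.card := by exact_mod_cast hQ.card_pos
  set n : ℝ := (Fintype.card V : ℝ) with hn'
  set a : ℝ := (Q.card : ℝ) ^ (1 / 4 : ℝ) with ha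
  have ha1 : 1 ≤ a := Real.one_le_rpow hp (by norm_num)
  have ha4 : a ^ 4 = Q.card := by
    have := rpow_one_div_pow (p := Q.card) (by positivity) 4 4
    simpa [ha] using this
  obtain ⟨H, hHG, ⟨b, hH, hb⟩, B, hBQ, hB, happ⟩ :=
    π.exists_plus_six ε hε Q ⌈a⌉₊ ⌊n / a ^ 3⌋₊ ⌈12 * a ^ 2⌉₊
  have hd := ceil_le_add (x := a) (by positivity) ha1
  have hk := Nat.floor_le (a := n / a ^ 3) (by positivity)
  have hj := ceil_le_add (x := 12 * a ^ 2) (by positivity) (one_le_pow₀ ha1 (n := 2))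
  refine ⟨H, hHG, ?_, B, hBQ, hB.trans ?_, happ⟩
  · have h1 := (Nat.cast_le (α := ℝ)).2 hH
    push_cast at h1
    rw [← ha4, ← hn'] at h1
    have h2 : (b : ℝ) ≤ 78 * (n * a) * (1 + 8 / ε) := by
      have h3 : a * b ≤ a * (78 * (n * a) * (1 + 8 / ε)) := by
        calc a * b ≤ ⌈a⌉₊ * b := by gcongr; exact Nat.le_ceil _
          _ ≤ _ := hb
          _ ≤ 3 * (2 * (12 * a ^ 2 + a ^ 2) * n * (1 + 8 / ε)) := by gcongr
          _ = _ := by ring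
      exact le_of_mul_le_mul_left h3 (by positivity)
    calc (numEdges H : ℝ) ≤ n * (a + a) + 4 * (a ^ 4 * (n / a ^ 3)) +
          78 * (n * a) * (1 + 8 / ε) := h1.trans (by gcongr)
      _ = (84 + 624 / ε) * (n * a) := by field_simp; ring
  · have h2 := exp_hit_le hn (A := 12 * a ^ 2) (D := a) (E := n / a ^ 3) (by positivity)
      (by positivity) (by positivity) (Nat.le_ceil _) (Nat.le_ceil _) (Nat.lt_floor_add_one _).le
      (f := 6) (by norm_num) (le_of_eq (by field_simp; ring))
    gcongr
    linarith

/-- With `n = a ^ 5`, the parameters are `d = a ^ 2`, `k = 0` and `L = a`. The hitting sets are larger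
by a factor `log n` than for a constant fraction of the pairs, so that no pair remains. -/
theorem ShortestPaths.exists_allPairsSpanner_four [Fintype V] (π : G.ShortestPaths) :
    ∃ H, IsAllPairsSpanner π 4 H ∧ (H.edgeSet.ncard : ℝ) ≤
      3000 * ((Fintype.card V : ℝ) ^ (7 / 5 : ℝ) * Real.log (Fintype.card V) ^ 2) := by
  classical
  rcases le_or_gt (Fintype.card V) 1 with hle | hlt
  · have := Fintype.card_le_one_iff_subsingleton.1 hle
    refine ⟨⊥, isPairwiseSpanner_of_approx bot_le ?_, by simp; positivity⟩
    rintro ⟨⟨s, t⟩, h⟩ -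
    obtain rfl := Subsingleton.elim s t
    exact ⟨.nil, by rw [len_nil]; exact add_nonneg (len_nonneg _) (by positivity)⟩
  set n : ℝ := (Fintype.card V : ℝ) with hn'
  have hn2 : 2 ≤ n := by rw [hn']; exact_mod_cast hlt
  have hn : 0 < n := by linarith
  set a : ℝ := n ^ (1 / 5 : ℝ) with ha
  have ha1 : 1 ≤ a := Real.one_le_rpow (by linarith) (by norm_num)
  have ha5 : a ^ 5 = n := by
    have := rpow_one_div_pow hn.le 5 5
    simpa [ha] using this
  have ha7 : n ^ (7 / 5 : ℝ) = a ^ 7 := by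
    have := rpow_one_div_pow hn.le 5 7
    simpa [ha] using this.symm
  set l : ℝ := Real.log n with hl
  have hl1 : 1 ≤ 2 * l := by
    have h1 := Real.log_le_log two_pos hn2
    have h2 := Real.log_two_gt_d9
    linarith
  have hl0 : 0 < l := by linarith
  obtain ⟨H, hHG, hH, B, -, hB, happ⟩ := π.exists_plus_four Finset.univ
    ⌈a ^ 2⌉₊ 0 ⌊a⌋₊ ⌈12 * (a ^ 2 * l)⌉₊ ⌈24 * (a ^ 3 * l)⌉₊
  have hexp : Real.exp (-(4 * l)) * n ^ 4 = 1 := by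
    rw [← Real.exp_log hn, ← Real.exp_nat_mul, ← Real.exp_add, ← hl]
    simp
  have key : ∀ {x : ℝ}, 4 * l ≤ x → Real.exp (-x) ≤ Real.exp (-(4 * l)) := fun h =>
    Real.exp_le_exp.2 (by linarith)
  have hd := ceil_le_add (x := a ^ 2) (by positivity) (one_le_pow₀ ha1 (n := 2))
  have hL := Nat.floor_le (a := a) (by positivity)
  have hj₁ := ceil_le_add (x := 12 * (a ^ 2 * l)) (by positivity)
    (hl1.trans (by nlinarith [one_le_pow₀ ha1 (n := 2)] : 2 * l ≤ 2 * (a ^ 2 * l)))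
  have hj₂ := ceil_le_add (x := 24 * (a ^ 3 * l)) (by positivity)
    (hl1.trans (by nlinarith [one_le_pow₀ ha1 (n := 3)] : 2 * l ≤ 2 * (a ^ 3 * l)))
  have hB0 : B = ∅ := by
    have h1 : (Finset.univ : Finset G.ConnectedPair).card ≤ n ^ 2 := by
      have := Fintype.card_subtype_le fun i : V × V => G.graph.Reachable i.1 i.2
      rw [Fintype.card_prod] at this
      rw [Finset.card_univ, sq, hn']
      exact_mod_cast this
    have e1 : 4 * l ≤ ⌈12 * (a ^ 2 * l)⌉₊ * ((⌈a ^ 2⌉₊ * (⌊a⌋₊ + 1) / 3 : ℝ) / n) := by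
      calc 4 * l = 12 * (a ^ 2 * l) * ((a ^ 2 * a / 3) / n) := by
            rw [← ha5]; field_simp; ring
        _ ≤ _ := by
          gcongr
          exacts [Nat.le_ceil _, Nat.le_ceil _, (Nat.lt_floor_add_one _).le]
    have e2 : 4 * l ≤ ⌈24 * (a ^ 3 * l)⌉₊ * ((⌈a ^ 2⌉₊ * ((0 : ℕ) + 1) / 6 : ℝ) / n) := by
      calc 4 * l = 24 * (a ^ 3 * l) * ((a ^ 2 * ((0 : ℕ) + 1) / 6) / n) := by
            rw [← ha5]; field_simp; norm_num
        _ ≤ _ := by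
          gcongr
          exacts [Nat.le_ceil _, Nat.le_ceil _]
    have h2 : (B.card : ℝ) ≤ 3 * Real.exp (-(4 * l)) * n ^ 2 := by
      refine hB.trans (mul_le_mul ?_ h1 (by positivity) (by positivity))
      linarith [key e1, key e2]
    have h3 : (B.card : ℝ) * n ^ 2 ≤ 3 := by
      calc (B.card : ℝ) * n ^ 2 ≤ 3 * Real.exp (-(4 * l)) * n ^ 2 * n ^ 2 := by gcongr
        _ = 3 := by linear_combination 3 * hexp
    rw [← Finset.card_eq_zero]
    by_contra hne
    have h4 : (1 : ℝ) ≤ B.card := by exact_mod_cast Nat.pos_of_ne_zero hne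
    nlinarith
  refine ⟨H, isPairwiseSpanner_of_approx hHG fun i _ => happ i (Finset.mem_univ _) (by simp [hB0]),
    ?_⟩
  have h1 := (Nat.cast_le (α := ℝ)).2 hH
  push_cast at h1
  rw [← hn', mul_zero, mul_zero, add_zero] at h1
  rw [ha7]
  have hl2 : 1 ≤ 4 * l ^ 2 := by nlinarith
  have hl3 : l ≤ 2 * l ^ 2 := by nlinarith
  have ha70 : 0 < a ^ 7 := by positivity
  calc (numEdges H : ℝ) ≤ a ^ 5 * (a ^ 2 + a ^ 2) + (12 * (a ^ 2 * l) + 2 * (a ^ 2 * l)) * a ^ 5 +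
        (24 * (a ^ 3 * l) + 2 * (a ^ 3 * l)) * (24 * (a ^ 3 * l) + 2 * (a ^ 3 * l)) * a := by
        rw [ha5]; exact h1.trans (by gcongr)
    _ = a ^ 7 * (2 + 14 * l + 676 * l ^ 2) := by ring
    _ ≤ a ^ 7 * (3000 * l ^ 2) := by gcongr; linarith
    _ = _ := by ring

end WeightedGraph

theorem theorem1 :
    -- (1) deterministic pairwise +(2+ε)W spanners on poly(1/ε) n |P|^(1/3) edges
    (∃ q : Polynomial ℝ, ∀ ε : ℝ≥0, 0 < ε →
      ∃ F : DeterministicConstruction.{u},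
        ∀ (V : Type u) [Fintype V] (G : WeightedGraph V) (π : G.ShortestPaths)
          (P : Finset (V × V)),
          WeightedGraph.IsPairwiseSpanner π (2 + ε) (P : Set (V × V)) (F V G π P) ∧
          ((F V G π P).edgeSet.ncard : ℝ) ≤
            q.eval (1 / (ε : ℝ)) *
              ((Fintype.card V : ℝ) * (P.card : ℝ) ^ (1 / 3 : ℝ))) ∧
    -- (2) deterministic pairwise +(6+ε)W spanners on poly(1/ε) n |P|^(1/4) edges
    (∃ q : Polynomial ℝ, ∀ ε : ℝ≥0, 0 < ε →
      ∃ F : DeterministicConstruction.{u},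
        ∀ (V : Type u) [Fintype V] (G : WeightedGraph V) (π : G.ShortestPaths)
          (P : Finset (V × V)),
          WeightedGraph.IsPairwiseSpanner π (6 + ε) (P : Set (V × V)) (F V G π P) ∧
          ((F V G π P).edgeSet.ncard : ℝ) ≤
            q.eval (1 / (ε : ℝ)) *
              ((Fintype.card V : ℝ) * (P.card : ℝ) ^ (1 / 4 : ℝ))) ∧
    -- (3) pairwise +2W spanners on O(n |P|^(1/3)) edges
    (∃ C : ℝ, ∀ (V : Type u) [Fintype V] (G : WeightedGraph V) (π : G.ShortestPaths)
      (P : Finset (V × V)), ∃ H : SimpleGraph V,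
        WeightedGraph.IsPairwiseSpanner π 2 (P : Set (V × V)) H ∧
        (H.edgeSet.ncard : ℝ) ≤
          C * ((Fintype.card V : ℝ) * (P.card : ℝ) ^ (1 / 3 : ℝ))) ∧
    -- (4) pairwise +4W spanners on O(n |P|^(2/7)) edges
    (∃ C : ℝ, ∀ (V : Type u) [Fintype V] (G : WeightedGraph V) (π : G.ShortestPaths)
      (P : Finset (V × V)), ∃ H : SimpleGraph V,
        WeightedGraph.IsPairwiseSpanner π 4 (P : Set (V × V)) H ∧
        (H.edgeSet.ncard : ℝ) ≤
          C * ((Fintype.card V : ℝ) * (P.card : ℝ) ^ (2 / 7 : ℝ))) ∧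
    -- (5) all-pairs +4W spanners on O(n^(7/5)) edges, up to a power of log n
    (∃ (C : ℝ) (k : ℕ), ∀ (V : Type u) [Fintype V] (G : WeightedGraph V)
      (π : G.ShortestPaths), ∃ H : SimpleGraph V,
        WeightedGraph.IsAllPairsSpanner π 4 H ∧
        (H.edgeSet.ncard : ℝ) ≤
          C * ((Fintype.card V : ℝ) ^ (7 / 5 : ℝ) *
            Real.log (Fintype.card V : ℝ) ^ k)) := by
  have h2 : ∃ C : ℝ, ∀ (V : Type u) [Fintype V] (G : WeightedGraph V) (π : G.ShortestPaths)
      (P : Finset (V × V)), ∃ H : SimpleGraph V,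
        WeightedGraph.IsPairwiseSpanner π 2 (P : Set (V × V)) H ∧
        (H.edgeSet.ncard : ℝ) ≤
          C * ((Fintype.card V : ℝ) * (P.card : ℝ) ^ (1 / 3 : ℝ)) :=
    ⟨_, fun V _ G π P =>
      π.exists_pairwiseSpanner 2 (by norm_num) (by norm_num) π.exists_most_plus_two P⟩
  refine ⟨?_, ?_, h2, ?_, ⟨3000, 2, fun V _ G π => π.exists_allPairsSpanner_four⟩⟩
  · -- The graphs with the smaller error `2 * W` serve here, for every `ε`.
    obtain ⟨C, hC⟩ := h2
    choose F hF hFC using hC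
    refine ⟨Polynomial.C C, fun ε _ => ⟨F, fun V _ G π P => ⟨(hF V G π P).mono ?_, ?_⟩⟩⟩
    · exact le_self_add
    · rw [Polynomial.eval_C]
      exact hFC V G π P
  · have hθ : ((3 : ℝ) / 4) ^ (1 / 4 : ℝ) < 1 :=
      Real.rpow_lt_one (by norm_num) (by norm_num) (by norm_num)
    refine ⟨Polynomial.C (1 - (3 / 4) ^ (1 / 4 : ℝ))⁻¹ *
      (Polynomial.C 84 + Polynomial.C 624 * Polynomial.X), fun ε hε => ?_⟩
    have h6 := fun (V : Type u) [Fintype V] (G : WeightedGraph V) (π : G.ShortestPaths)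
        (P : Finset (V × V)) =>
      π.exists_pairwiseSpanner (6 + ε) (by norm_num) (by positivity)
        (π.exists_most_plus_six ε hε) P
    choose F hF hFC using h6
    refine ⟨F, fun V _ G π P => ⟨hF V G π P, (hFC V G π P).trans (le_of_eq ?_)⟩⟩
    simp only [Polynomial.eval_mul, Polynomial.eval_add, Polynomial.eval_C, Polynomial.eval_X]
    ring
  · exact ⟨_, fun V _ G π P =>
      π.exists_pairwiseSpanner 4 (by norm_num) (by norm_num) π.exists_most_plus_four P⟩
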